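/- Let $R$ be a ring with unit and let $I$ be a small cofiltered category. Let $G_\bullet=\{G_i,\phi^G_{ij}\}$ be an $I$-diagram of finite discrete groups and surjective homomorphisms and $X_\bullet=\{X_i,\phi_{ij}\}$ an $I$-diagram of finite discrete spaces and surjective maps, where each $X_i$ is a $G_i$-space and $\phi_{ij}(gx)=\phi^G_{ij}(g)\,\phi_{ij}(x)$. Let $G=\lim_i G_i$ and $X=\lim_i X_i$, with projections $p_i^G\colon G\to G_i$ and $p_i\colon X\to X_i$; then $X$ is a $G$-space. For a topological group $\Gamma$ and a $\Gamma$-space $Z$, a $\Gamma$-sheaf of (left) $R$-modules over $Z$ is a sheaf space of $R$-modules $E\to Z$ (a local homeomorphism whose fibres are $R$-modules, with continuous fibrewise subtraction and scalar multiplications) with a continuous action of $\Gamma$ on $E$ such that $E\to Z$ is equivariant and each $g\colon E_z\to E_{gz}$ is $R$-linear. Maps are continuous equivariant maps over $Z$ that are $R$-linear on fibres. If $\Gamma\to\Gamma'$ is a continuous surjection with kernel $N$ onto a discrete group and $p\colon Z\to Z'$ is a continuous map to a discrete $\Gamma'$-space that is equivariant along it, then $\bar p^*D=Z\times_{Z'}D$,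 with $\Gamma$ acting on $D$ through $\Gamma'$, defines a functor from $\Gamma'$-sheaves over $Z'$ to $\Gamma$-sheaves over $Z$. It is left adjoint to $\bar p_*$, where $\bar p_*E$ is the sheaf $V\mapsto E(p^{-1}V)^{N}$ with the induced action of $\Gamma'\cong\Gamma/N$. A $G_\bullet$-sheaf $D_\bullet$ of $R$-modules over $X_\bullet$ consists of a $G_i$-sheaf $D_i$ of $R$-modules over $X_i$ for each $i$ and a map of $G_i$-sheaves $\alpha_{ij}\colon\bar\phi_{ij}^*D_j\to D_i$ for each morphism $i\to j$ of $I$, functorially: identities of $I$ give identities, and composites give composites, under $\bar\phi_{ik}^*=\bar\phi_{ij}^*\bar\phi_{jk}^*$. Maps $D_\bullet\to D'_\bullet$ are families of maps of $G_i$-sheaves $D_i\to D'_i$ that commute with the structure maps. Write $\bar\alpha_{ij}\colon D_j\to(\bar\phi_{ij})_*D_i$ for the adjoint of $\alpha_{ij}$. For a $G$-sheaf $E$ of $R$-modules over $X$ let $\bar p_\bullet E$ be the $G_\bullet$-sheaf formed by the $(\bar p_i)_*E$, with structure maps adjoint to the canonical identifications $(\bar p_j)_*E=(\bar\phi_{ij})_*(\bar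 p_i)_*E$. For a $G_\bullet$-sheaf $D_\bullet$ the $G$-sheaves $\bar p_i^*D_i$ form a diagram indexed by $I^{op}$, with transition maps $\bar p_j^*D_j=\bar p_i^*\bar\phi_{ij}^*D_j\to\bar p_i^*D_i$ given by $\alpha_{ij}$. **Theorem.** Colimits of shape $I^{op}$ exist in the category of $G$-sheaves of $R$-modules over $X$, and the functor $D_\bullet\mapsto\operatorname{colim}_i\bar p_i^*D_i$ from $G_\bullet$-sheaves of $R$-modules over $X_\bullet$ to $G$-sheaves of $R$-modules over $X$ is left adjoint to $\bar p_\bullet$. The counit of this adjunction is an isomorphism. Moreover $\bar p_\bullet$ takes values in the full subcategory of those $D_\bullet$ for which all the adjoint structure maps $\bar\alpha_{ij}\colon D_j\to(\bar\phi_{ij})_*D_i$ are isomorphisms, and the adjunction restricts to an equivalence between this full subcategory and the category of $G$-sheaves of $R$-modules over $X$. -/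

import Mathlib

open CategoryTheory CategoryTheory.Limits Topology

universe u

namespace EquivariantSheaf

/-! ### `G`-sheaves of `R`-modules, as sheaf spaces -/

/-- A `G`-equivariant sheaf of `R`-modules over the `G`-space `X`, presented as a sheaf space.
The total space is `Σ x, stalk x`, with projection `Sigma.fst`, so that the fibre over `x` is
`stalk x`. The group acts on the total space by `g • ⟨x, e⟩ = ⟨g • x, act g rfl e⟩`; in order to
avoid transports, `act g h : stalk x → stalk y` takes a proof `h` that `g • x = y`. -/
structure GSheaf (R : Type u) [Ring R] (G : Type u) [Group G] [TopologicalSpace G]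
    (X : Type u) [TopologicalSpace X] [MulAction G X] where
  /-- the fibre over `x`, which is also the stalk at `x` -/
  stalk : X → Type u
  [addCommGroup : ∀ x, AddCommGroup (stalk x)]
  [module : ∀ x, Module R (stalk x)]
  /-- the topology of the total space -/
  [top : TopologicalSpace (Σ x, stalk x)]
  /-- the action of `g` on the fibres; it is a map of `R`-modules -/
  act (g : G) {x y : X} (h : g • x = y) : stalk x →ₗ[R] stalk y
  act_one {x : X} (h : (1 : G) • x = x) (e : stalk x) : act 1 h e = e
  act_mul (g k : G) {x y z : X} (hk : k • x = y) (hg : g • y = z) (hgk : (g * k) • x = z)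
    (e : stalk x) : act (g * k) hgk e = act g hg (act k hk e)
  /-- the projection is a local homeomorphism -/
  isLocalHomeomorph : IsLocalHomeomorph (Sigma.fst : (Σ x, stalk x) → X)
  /-- fibrewise subtraction is continuous on the fibre product of the total space with itself,
  which is written here as `Σ x, stalk x × stalk x` with the subspace topology -/
  continuous_sub : Continuous[TopologicalSpace.induced
      (fun q : (Σ x, stalk x × stalk x) =>
        ((⟨q.1, q.2.1⟩ : Σ x, stalk x), (⟨q.1, q.2.2⟩ : Σ x, stalk x))) inferInstance, top]
      (fun q : (Σ x, stalk x × stalk x) => (⟨q.1, q.2.1 - q.2.2⟩ : Σ x, stalk x))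
  /-- fibrewise multiplication by a scalar is continuous -/
  continuous_smul (r : R) :
    Continuous (fun e : (Σ x, stalk x) => (⟨e.1, r • e.2⟩ : Σ x, stalk x))
  /-- the action of `G` on the total space is continuous -/
  continuous_act :
    Continuous (fun q : G × (Σ x, stalk x) => (⟨q.1 • q.2.1, act q.1 rfl q.2.2⟩ : Σ x, stalk x))

attribute [instance] GSheaf.addCommGroup GSheaf.module GSheaf.top

namespace GSheaf

section

variable {R : Type u} [Ring R] {G : Type u} [Group G] [TopologicalSpace G]
  {X : Type u} [TopologicalSpace X] [MulAction G X]

/-- The total space of a `G`-sheaf. -/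
abbrev Total (E : GSheaf R G X) : Type u := Σ x, E.stalk x

/-- A map of `G`-sheaves of `R`-modules over `X`: a continuous `G`-equivariant map of total spaces
over `X` which is `R`-linear on each fibre. -/
@[ext]
structure Hom (E F : GSheaf R G X) where
  app (x : X) : E.stalk x →ₗ[R] F.stalk x
  app_act (g : G) {x y : X} (h : g • x = y) (e : E.stalk x) :
    app y (E.act g h e) = F.act g h (app x e)
  continuous_app : Continuous (fun e : E.Total => (⟨e.1, app e.1 e.2⟩ : F.Total))

instance : Category (GSheaf R G X) where
  Hom := Hom
  id E := ⟨fun _ => LinearMap.id, fun _ _ _ _ _ => rfl, continuous_id⟩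
  comp f g := ⟨fun x => (g.app x).comp (f.app x),
    fun k x y h e => by simp [f.app_act, g.app_act],
    g.continuous_app.comp f.continuous_app⟩

@[ext]
theorem hom_ext {E F : GSheaf R G X} {f g : E ⟶ F}
    (h : ∀ (x : X) (e : E.stalk x), f.app x e = g.app x e) : f = g :=
  Hom.ext (funext fun x => LinearMap.ext (h x))

@[simp]
theorem id_app (E : GSheaf R G X) (x : X) (e : E.stalk x) : Hom.app (𝟙 E) x e = e := rfl

@[simp]
theorem comp_app {E F K : GSheaf R G X} (f : E ⟶ F) (g : F ⟶ K) (x : X) (e : E.stalk x) :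
    Hom.app (f ≫ g) x e = g.app x (f.app x e) := rfl

/-- Transport between the stalks at equal points. -/
def cast (E : GSheaf R G X) {x y : X} (h : x = y) : E.stalk x →ₗ[R] E.stalk y :=
  E.act 1 (by rw [one_smul, h])

@[simp]
theorem cast_rfl (E : GSheaf R G X) {x : X} (h : x = x) (e : E.stalk x) : E.cast h e = e :=
  E.act_one _ e

theorem mk_cast (E : GSheaf R G X) {x y : X} (h : x = y) (e : E.stalk x) :
    (⟨y, E.cast h e⟩ : E.Total) = ⟨x, e⟩ := by
  subst h; simp

@[simp]
theorem cast_cast (E : GSheaf R G X) {x y z : X} (h : x = y) (h' : y = z) (e : E.stalk x) :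
    E.cast h' (E.cast h e) = E.cast (h.trans h') e := by
  subst h; subst h'; simp

theorem act_cast (E : GSheaf R G X) {g : G} {x y z : X} (h : x = y) (hy : g • y = z)
    (e : E.stalk x) : E.act g hy (E.cast h e) = E.act g (h ▸ hy) e := by
  subst h; simp

theorem cast_act (E : GSheaf R G X) {g : G} {x y z : X} (hx : g • x = y) (h : y = z)
    (e : E.stalk x) : E.cast h (E.act g hx e) = E.act g (hx.trans h) e := by
  subst h; simp

theorem act_congr (E : GSheaf R G X) {g k : G} (hgk : g = k) {x y : X} (hg : g • x = y)
    (hk : k • x = y) (e : E.stalk x) : E.act g hg e = E.act k hk e := by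
  subst hgk; rfl

theorem mk_act (E : GSheaf R G X) (g : G) {x y : X} (h : g • x = y) (e : E.stalk x) :
    (⟨g • x, E.act g rfl e⟩ : E.Total) = ⟨y, E.act g h e⟩ := by
  subst h; rfl

theorem Hom.app_cast {E F : GSheaf R G X} (f : E ⟶ F) {x y : X} (h : x = y) (e : E.stalk x) :
    f.app y (E.cast h e) = F.cast h (f.app x e) := f.app_act _ _ _

theorem continuous_zero (E : GSheaf R G X) :
    Continuous (fun x : X => (⟨x, 0⟩ : E.Total)) := by
  rw [continuous_iff_continuousAt]
  intro x
  have h1 : Continuous (fun e : E.Total => (⟨e.1, 0⟩ : E.Total)) := by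
    simpa using E.continuous_smul 0
  have h2 := E.isLocalHomeomorph.map_nhds_eq ⟨x, 0⟩
  unfold ContinuousAt
  rw [← h2]
  exact Filter.tendsto_map' (h1.tendsto ⟨x, 0⟩)

theorem continuous_sub_of (E : GSheaf R G X) {Z : Type*} [TopologicalSpace Z] (f : Z → X)
    (a b : (z : Z) → E.stalk (f z)) (ha : Continuous fun z => (⟨f z, a z⟩ : E.Total))
    (hb : Continuous fun z => (⟨f z, b z⟩ : E.Total)) :
    Continuous fun z => (⟨f z, a z - b z⟩ : E.Total) := by
  have h := E.continuous_sub
  let _ : TopologicalSpace (Σ x, E.stalk x × E.stalk x) := TopologicalSpace.induced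
      (fun q : (Σ x, E.stalk x × E.stalk x) =>
        ((⟨q.1, q.2.1⟩ : Σ x, E.stalk x), (⟨q.1, q.2.2⟩ : Σ x, E.stalk x))) inferInstance
  have hab : Continuous fun z => (⟨f z, (a z, b z)⟩ : Σ x, E.stalk x × E.stalk x) :=
    continuous_induced_rng.2 (ha.prodMk hb)
  exact h.comp hab

/-- The `R`-module of (continuous, not necessarily equivariant) sections of `E` over `U`. -/
def sections (E : GSheaf R G X) (U : Set X) : Submodule R ((x : U) → E.stalk x) where
  carrier := {s | Continuous fun x : U => (⟨x, s x⟩ : E.Total)}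
  zero_mem' := E.continuous_zero.comp continuous_subtype_val
  add_mem' := by
    intro s t hs ht
    have hz : Continuous fun x : U => (⟨x, 0⟩ : E.Total) :=
      E.continuous_zero.comp continuous_subtype_val
    have h := E.continuous_sub_of (fun x : U => (x : X)) s _ hs
      (E.continuous_sub_of (fun x : U => (x : X)) (fun _ => 0) t hz ht)
    simpa using h
  smul_mem' := fun r s hs => (E.continuous_smul r).comp hs

/-- The `N`-fixed sections over a set `U` which is stable under the subgroup `N`: those sections
`s` with `n ∗ s = s` for all `n ∈ N`, where `(n ∗ s) (n • x) = n • s x`. -/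
def fixedSections (E : GSheaf R G X) (N : Subgroup G) (U : Set X) :
    Submodule R ((x : U) → E.stalk x) where
  carrier := {s | s ∈ E.sections U ∧
    ∀ n ∈ N, ∀ (x x' : U) (h : n • (x : X) = x'), E.act n h (s x) = s x'}
  zero_mem' := ⟨zero_mem _, fun _ _ _ _ _ => map_zero _⟩
  add_mem' := fun {s t} hs ht => ⟨add_mem hs.1 ht.1, fun n hn x x' h => by
    simp [hs.2 n hn x x' h, ht.2 n hn x x' h]⟩
  smul_mem' := fun r s hs => ⟨Submodule.smul_mem _ r hs.1, fun n hn x x' h => by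
    simp [hs.2 n hn x x' h]⟩

end

end GSheaf

/-! ### Change of group and of base space -/

/-- A continuous map `X → Y` from a `G`-space to an `H`-space which is equivariant along a
continuous surjective homomorphism `G → H`. Thus `H` is the quotient of `G` by the kernel. -/
structure ChangeMap (G : Type u) [Group G] [TopologicalSpace G]
    (X : Type u) [TopologicalSpace X] [MulAction G X]
    (H : Type u) [Group H] [TopologicalSpace H]
    (Y : Type u) [TopologicalSpace Y] [MulAction H Y] where
  hom : G →* H
  map : X → Y
  continuous_hom : Continuous hom
  surjective_hom : Function.Surjective hom
  continuous_map : Continuous map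
  equivariant (g : G) (x : X) : map (g • x) = hom g • map x

namespace ChangeMap

open GSheaf

section

variable {R : Type u} [Ring R]
  {G : Type u} [Group G] [TopologicalSpace G]
  {X : Type u} [TopologicalSpace X] [MulAction G X]
  {H : Type u} [Group H] [TopologicalSpace H]
  {Y : Type u} [TopologicalSpace Y] [MulAction H Y]

theorem smul_map_of_smul (p : ChangeMap G X H Y) {g : G} {x x' : X} (h : g • x = x') :
    p.hom g • p.map x = p.map x' := by rw [← p.equivariant, h]

/-- The topology of the pullback `X ×_Y D`, written as `Σ x, D.stalk (p x)`: the subspace topology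
of the product `X × D`. -/
abbrev pullbackTop (p : ChangeMap G X H Y) (D : GSheaf R H Y) :
    TopologicalSpace (Σ x, D.stalk (p.map x)) :=
  TopologicalSpace.induced
    (fun q : (Σ x, D.stalk (p.map x)) => (q.1, (⟨p.map q.1, q.2⟩ : D.Total))) inferInstance

theorem pullback_isLocalHomeomorph (p : ChangeMap G X H Y) (D : GSheaf R H Y) :
    letI := p.pullbackTop D
    IsLocalHomeomorph (Sigma.fst : (Σ x, D.stalk (p.map x)) → X) := by
  let _ := p.pullbackTop D
  have hι : Continuous (fun q : (Σ x, D.stalk (p.map x)) =>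
    (q.1, (⟨p.map q.1, q.2⟩ : D.Total))) := continuous_induced_dom
  have hfst : Continuous (Sigma.fst : (Σ x, D.stalk (p.map x)) → X) := continuous_fst.comp hι
  have hopen : IsOpenMap (Sigma.fst : (Σ x, D.stalk (p.map x)) → X) := by
    rw [isOpenMap_iff_nhds_le]
    rintro ⟨x, e⟩ W hW
    obtain ⟨T, hT, hTW⟩ := (mem_nhds_induced _ _ _).1 (Filter.mem_map.1 hW)
    rw [nhds_prod_eq, Filter.mem_prod_iff] at hT
    obtain ⟨A, hA, B, hB, hAB⟩ := hT
    have hB' : Sigma.fst '' B ∈ 𝓝 (p.map x) := D.isLocalHomeomorph.isOpenMap.image_mem_nhds hB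
    have hB'' := p.continuous_map.continuousAt.preimage_mem_nhds hB'
    filter_upwards [hA, hB''] with x' hx' hx''
    obtain ⟨b, hb, hbx⟩ := hx''
    have hmem : (⟨x', D.cast hbx b.2⟩ : Σ x, D.stalk (p.map x)) ∈
        (fun q : (Σ x, D.stalk (p.map x)) => (q.1, (⟨p.map q.1, q.2⟩ : D.Total))) ⁻¹' T := by
      apply hAB
      refine ⟨hx', ?_⟩
      change (⟨p.map x', D.cast hbx b.2⟩ : D.Total) ∈ B
      rw [D.mk_cast]
      exact hb
    exact hTW hmem
  rw [isLocalHomeomorph_iff_isOpenEmbedding_restrict]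
  rintro ⟨x, e⟩
  obtain ⟨V, hV, hVe⟩ := isLocalHomeomorph_iff_isOpenEmbedding_restrict.1
    D.isLocalHomeomorph ⟨p.map x, e⟩
  obtain ⟨V', hV'V, hV', hVx⟩ := mem_nhds_iff.1 hV
  let U : Set (Σ x, D.stalk (p.map x)) := {q | (⟨p.map q.1, q.2⟩ : D.Total) ∈ V'}
  have hU : IsOpen U := hV'.preimage (continuous_snd.comp hι)
  refine ⟨U, hU.mem_nhds hVx, ?_⟩
  refine IsOpenEmbedding.of_continuous_injective_isOpenMap
    (hfst.comp continuous_subtype_val) ?_ (hopen.comp hU.isOpenMap_subtype_val)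
  rintro ⟨⟨x₁, e₁⟩, h₁⟩ ⟨⟨x₂, e₂⟩, h₂⟩ (h : x₁ = x₂)
  subst h
  have := @hVe.injective ⟨⟨p.map x₁, e₁⟩, hV'V h₁⟩ ⟨⟨p.map x₁, e₂⟩, hV'V h₂⟩ rfl
  simpa using this

/-- The pullback (inflation) `p̄^* D` of an `H`-sheaf over `Y`: its sheaf space is `X ×_Y D`, on
which `G` acts diagonally, through `G → H` on the second factor. -/
def pullbackObj (p : ChangeMap G X H Y) (D : GSheaf R H Y) [ContinuousSMul G X] :
    GSheaf R G X :=
  letI := p.pullbackTop D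
  have hι : Continuous (fun q : (Σ x, D.stalk (p.map x)) =>
    (q.1, (⟨p.map q.1, q.2⟩ : D.Total))) := continuous_induced_dom
  { stalk := fun x => D.stalk (p.map x)
    act := fun g x x' h => D.act (p.hom g) (p.smul_map_of_smul h)
    act_one := fun {x} h e => by
      rw [D.act_congr (map_one p.hom) _ (one_smul _ _), D.act_one]
    act_mul := fun g k {x y z} hk hg hgk e => by
      rw [← D.act_mul _ _ _ _ (by rw [← map_mul]; exact p.smul_map_of_smul hgk)]
      exact D.act_congr (map_mul _ _ _) _ _ _
    isLocalHomeomorph := p.pullback_isLocalHomeomorph D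
    continuous_sub := by
      let _ : TopologicalSpace (Σ x, D.stalk (p.map x) × D.stalk (p.map x)) :=
        TopologicalSpace.induced (fun q : (Σ x, D.stalk (p.map x) × D.stalk (p.map x)) =>
          ((⟨q.1, q.2.1⟩ : Σ x, D.stalk (p.map x)),
            (⟨q.1, q.2.2⟩ : Σ x, D.stalk (p.map x)))) inferInstance
      have h : Continuous (fun q : (Σ x, D.stalk (p.map x) × D.stalk (p.map x)) =>
          ((⟨q.1, q.2.1⟩ : Σ x, D.stalk (p.map x)),
            (⟨q.1, q.2.2⟩ : Σ x, D.stalk (p.map x)))) := continuous_induced_dom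
      refine continuous_induced_rng.2 (Continuous.prodMk ?_ ?_)
      · exact continuous_fst.comp (hι.comp (continuous_fst.comp h))
      · exact D.continuous_sub_of _ (fun q : (Σ x, D.stalk (p.map x) × D.stalk (p.map x)) => q.2.1)
          (fun q => q.2.2) (continuous_snd.comp (hι.comp (continuous_fst.comp h)))
          (continuous_snd.comp (hι.comp (continuous_snd.comp h)))
    continuous_smul := fun r => by
      refine continuous_induced_rng.2 (Continuous.prodMk ?_ ?_)
      · exact continuous_fst.comp hι
      · exact (D.continuous_smul r).comp (continuous_snd.comp hι)
    continuous_act := by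
      refine continuous_induced_rng.2 (Continuous.prodMk ?_ ?_)
      · exact continuous_fst.smul (continuous_fst.comp (hι.comp continuous_snd))
      · have h := D.continuous_act.comp ((p.continuous_hom.comp continuous_fst).prodMk
          (continuous_snd.comp (hι.comp (continuous_snd (X := G)))))
        exact h.congr fun q => D.mk_act _ _ _ }

theorem pullback_continuous (p : ChangeMap G X H Y) (D : GSheaf R H Y) [ContinuousSMul G X] :
    Continuous (fun q : (p.pullbackObj D).Total => (q.1, (⟨p.map q.1, q.2⟩ : D.Total))) :=
  continuous_induced_dom

theorem continuous_to_pullback (p : ChangeMap G X H Y) (D : GSheaf R H Y) [ContinuousSMul G X]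
    {Z : Type*} [TopologicalSpace Z] {a : Z → (p.pullbackObj D).Total}
    (h₁ : Continuous fun z => (a z).1)
    (h₂ : Continuous fun z => (⟨p.map (a z).1, (a z).2⟩ : D.Total)) : Continuous a :=
  continuous_induced_rng.2 (h₁.prodMk h₂)

/-- The functor `p̄^*`. -/
def pullback (R : Type u) [Ring R] (p : ChangeMap G X H Y) [ContinuousSMul G X] :
    GSheaf R H Y ⥤ GSheaf R G X where
  obj D := p.pullbackObj D
  map {D D'} f :=
    { app := fun x => f.app (p.map x)
      app_act := fun g x x' h e => f.app_act _ _ _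
      continuous_app := p.continuous_to_pullback D'
        (continuous_fst.comp (p.pullback_continuous D))
        (f.continuous_app.comp (continuous_snd.comp (p.pullback_continuous D))) }

theorem smul_mem_fibre (p : ChangeMap G X H Y) {g : G} {y y' : Y} (h : p.hom g • y = y')
    (x : p.map ⁻¹' {y'}) : g⁻¹ • (x : X) ∈ p.map ⁻¹' {y} := by
  have hx : p.map x = y' := x.2
  simp [p.equivariant, hx, ← h]

/-- Translation of a section over the fibre of `y` by an element `g` with `g • y = y'`; this is the
section `x ↦ g • s (g⁻¹ • x)` over the fibre of `y'`. -/
def translate (p : ChangeMap G X H Y) (E : GSheaf R G X) [ContinuousSMul G X] (g : G)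
    {y y' : Y} (h : p.hom g • y = y') :
    E.fixedSections p.hom.ker (p.map ⁻¹' {y}) →ₗ[R] E.fixedSections p.hom.ker (p.map ⁻¹' {y'}) where
  toFun s := ⟨fun x => E.act g (smul_inv_smul g (x : X)) (s.1 ⟨g⁻¹ • (x : X), p.smul_mem_fibre h x⟩),
    by
      have h1 : Continuous fun x : p.map ⁻¹' {y'} =>
          (⟨g⁻¹ • (x : X), p.smul_mem_fibre h x⟩ : p.map ⁻¹' {y}) :=
        Continuous.subtype_mk (continuous_subtype_val.const_smul _) _
      have h2 := E.continuous_act.comp ((continuous_const (y := g)).prodMk (s.2.1.comp h1))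
      exact h2.congr fun x => E.mk_act _ _ _, by
      intro n hn x x' hx
      have hn' : g⁻¹ * n * g ∈ p.hom.ker := by
        rw [MonoidHom.mem_ker] at hn ⊢
        simp [hn]
      have key := s.2.2 _ hn' ⟨g⁻¹ • (x : X), p.smul_mem_fibre h x⟩
        ⟨g⁻¹ • (x' : X), p.smul_mem_fibre h x'⟩ (by simp [mul_smul, hx])
      have hk : (n * g) • g⁻¹ • (x : X) = x' := by rw [mul_smul, smul_inv_smul, hx]
      have hk' : (g * (g⁻¹ * n * g)) • g⁻¹ • (x : X) = x' := by
        rw [← hk]; congr 1; group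
      dsimp only
      rw [← key, ← E.act_mul n g _ _ hk, ← E.act_mul g (g⁻¹ * n * g) _ _ hk']
      exact E.act_congr (by group) _ _ _⟩
  map_add' s t := by ext x; simp
  map_smul' r s := by ext x; simp

theorem translate_apply (p : ChangeMap G X H Y) (E : GSheaf R G X) [ContinuousSMul G X] (g : G)
    {y y' : Y} (h : p.hom g • y = y') (s : E.fixedSections p.hom.ker (p.map ⁻¹' {y}))
    (k : G) (hk : p.hom k = p.hom g) (x : p.map ⁻¹' {y}) (x' : p.map ⁻¹' {y'})
    (hx : k • (x : X) = x') :
    (p.translate E g h s).1 x' = E.act k hx (s.1 x) := by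
  have hn : g⁻¹ * k ∈ p.hom.ker := by simp [MonoidHom.mem_ker, hk]
  have key := s.2.2 _ hn x ⟨g⁻¹ • (x' : X), p.smul_mem_fibre h x'⟩ (by simp [mul_smul, hx])
  change E.act g _ (s.1 ⟨g⁻¹ • (x' : X), p.smul_mem_fibre h x'⟩) = _
  rw [← key, ← E.act_mul g (g⁻¹ * k) _ _ (by simpa using hx)]
  exact E.act_congr (by group) _ _ _

theorem surjInv_smul (p : ChangeMap G X H Y) {h : H} {y y' : Y} (hy : h • y = y') :
    p.hom (Function.surjInv p.surjective_hom h) • y = y' := by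
  rw [Function.surjInv_eq p.surjective_hom, hy]

theorem app_act_of_pullback [ContinuousSMul G X] (p : ChangeMap G X H Y) {D : GSheaf R H Y} {E : GSheaf R G X}
    (α : (pullback R p).obj D ⟶ E) (g : G) {x x' : X} (hx : g • x = x')
    (h : p.hom g • p.map x = p.map x') (d : D.stalk (p.map x)) :
    α.app x' (D.act (p.hom g) h d : D.stalk (p.map x')) = E.act g hx (α.app x d) :=
  α.app_act g hx d

theorem continuous_of_fibre [DiscreteTopology Y] [ContinuousSMul G X] (p : ChangeMap G X H Y) {D : GSheaf R H Y} {E : GSheaf R G X}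
    (b : (y : Y) → D.stalk y → E.fixedSections p.hom.ker (p.map ⁻¹' {y})) :
    Continuous (fun q : (p.pullbackObj D).Total =>
      (⟨q.1, (b (p.map q.1) q.2).1 ⟨q.1, rfl⟩⟩ : E.Total)) := by
  have : DiscreteTopology D.Total := D.isLocalHomeomorph.comap_discreteTopology
  rw [continuous_iff_continuousAt]
  rintro ⟨x₀, d₀⟩
  let d₀' : D.stalk (p.map x₀) := d₀
  let U : Set (p.pullbackObj D).Total := {q | (⟨p.map q.1, q.2⟩ : D.Total) = ⟨p.map x₀, d₀'⟩}
  have hs : Continuous (fun q : (p.pullbackObj D).Total => (⟨p.map q.1, q.2⟩ : D.Total)) :=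
    continuous_snd.comp (p.pullback_continuous D)
  have hU : IsOpen U := (isOpen_discrete ({(⟨p.map x₀, d₀'⟩ : D.Total)} : Set D.Total)).preimage hs
  have hUx : (⟨x₀, d₀⟩ : (p.pullbackObj D).Total) ∈ U := rfl
  refine ContinuousOn.continuousAt ?_ (hU.mem_nhds hUx)
  rw [continuousOn_iff_continuous_domRestrict]
  have hmem : ∀ q : U, q.1.1 ∈ p.map ⁻¹' {p.map x₀} := fun q => congrArg Sigma.fst q.2
  have hc := (b (p.map x₀) d₀').2.1.comp (f := fun q : U =>
    (⟨q.1.1, hmem q⟩ : p.map ⁻¹' {p.map x₀})) (Continuous.subtype_mk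
      (continuous_fst.comp ((p.pullback_continuous D).comp continuous_subtype_val)) _)
  refine hc.congr ?_
  rintro ⟨⟨x, d⟩, hq⟩
  have key : ∀ (t : D.Total) (hd : t = ⟨p.map x₀, d₀'⟩) (ht : p.map x = t.1),
      (b (p.map x₀) d₀').1 ⟨x, ht.trans (congrArg Sigma.fst hd)⟩ = (b t.1 t.2).1 ⟨x, ht⟩ := by
    rintro t rfl ht; rfl
  exact congrArg (Sigma.mk x) (key ⟨p.map x, d⟩ hq rfl)

variable [DiscreteTopology H] [DiscreteTopology Y] [ContinuousSMul G X]

/-- The push-forward `p̄_* E` over a discrete space `Y`, where `N = ker (G → H)`: the sheaf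
`V ↦ E (p⁻¹ V) ^ N`. As `Y` is discrete, its stalk at `y` is the value `E (p⁻¹ {y}) ^ N` on the open
set `{y}`, and the total space is discrete. An element `h` of `H` acts through any lift of `h`
to `G`. -/
noncomputable def pushforwardObj (p : ChangeMap G X H Y) (E : GSheaf R G X) : GSheaf R H Y :=
  letI top : TopologicalSpace (Σ y, E.fixedSections p.hom.ker (p.map ⁻¹' {y})) := ⊥
  haveI disc : DiscreteTopology (Σ y, E.fixedSections p.hom.ker (p.map ⁻¹' {y})) := ⟨rfl⟩
  { stalk := fun y => E.fixedSections p.hom.ker (p.map ⁻¹' {y})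
    top := top
    act := fun h _ _ hy => p.translate E (Function.surjInv p.surjective_hom h) (p.surjInv_smul hy)
    act_one := fun {y} hy s => by
      refine Subtype.ext (funext fun x => ?_)
      rw [p.translate_apply E _ _ s 1 (by rw [Function.surjInv_eq p.surjective_hom, map_one]) x x (one_smul _ _),
        E.act_one]
    act_mul := fun h k {x y z} hk hh hhk s => by
      refine Subtype.ext (funext fun x' => ?_)
      set a := Function.surjInv p.surjective_hom h
      set b := Function.surjInv p.surjective_hom k
      have ha : p.hom a = h := Function.surjInv_eq p.surjective_hom _
      have hb : p.hom b = k := Function.surjInv_eq p.surjective_hom _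
      have hx : (a * b) • b⁻¹ • a⁻¹ • (x' : X) = x' := by simp [mul_smul]
      rw [p.translate_apply E _ _ s (a * b) (by rw [Function.surjInv_eq p.surjective_hom, map_mul, ha, hb])
        ⟨b⁻¹ • a⁻¹ • (x' : X), p.smul_mem_fibre (by rw [hb, hk])
          ⟨_, p.smul_mem_fibre (by rw [ha, hh]) x'⟩⟩ x' hx]
      exact E.act_mul _ _ _ _ _ _
    isLocalHomeomorph := by
      rw [isLocalHomeomorph_iff_isOpenEmbedding_restrict]
      intro q
      refine ⟨{q}, (isOpen_discrete _).mem_nhds rfl, ?_⟩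
      exact IsOpenEmbedding.of_continuous_injective_isOpenMap continuous_of_discreteTopology
        (Function.injective_of_subsingleton _) fun _ _ => isOpen_discrete _
    continuous_sub := by
      let _ : TopologicalSpace (Σ y, E.fixedSections p.hom.ker (p.map ⁻¹' {y}) ×
          E.fixedSections p.hom.ker (p.map ⁻¹' {y})) := TopologicalSpace.induced
        (fun q => ((⟨q.1, q.2.1⟩ : Σ y, E.fixedSections p.hom.ker (p.map ⁻¹' {y})),
          (⟨q.1, q.2.2⟩ : Σ y, E.fixedSections p.hom.ker (p.map ⁻¹' {y})))) inferInstance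
      have : DiscreteTopology (Σ y, E.fixedSections p.hom.ker (p.map ⁻¹' {y}) ×
          E.fixedSections p.hom.ker (p.map ⁻¹' {y})) := by
        refine DiscreteTopology.of_continuous_injective (continuous_induced_dom
          (f := fun q : (Σ y, E.fixedSections p.hom.ker (p.map ⁻¹' {y}) ×
            E.fixedSections p.hom.ker (p.map ⁻¹' {y})) =>
            ((⟨q.1, q.2.1⟩ : Σ y, E.fixedSections p.hom.ker (p.map ⁻¹' {y})),
              (⟨q.1, q.2.2⟩ : Σ y, E.fixedSections p.hom.ker (p.map ⁻¹' {y}))))) ?_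
        rintro ⟨y, s, t⟩ ⟨y', s', t'⟩ h
        simp only [Prod.mk.injEq, Sigma.mk.injEq] at h
        obtain ⟨⟨rfl, h⟩, -, h'⟩ := h
        rw [heq_eq_eq] at h h'
        rw [h, h']
      exact continuous_of_discreteTopology
    continuous_smul := fun _ => continuous_of_discreteTopology
    continuous_act := continuous_of_discreteTopology }

instance (p : ChangeMap G X H Y) (E : GSheaf R G X) :
    DiscreteTopology (p.pushforwardObj E).Total := ⟨rfl⟩

/-- The sections of `p̄_* E` over any `V` are the `N`-fixed sections of `E` over `p⁻¹ V`. -/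
noncomputable def pushforwardSections (p : ChangeMap G X H Y) (E : GSheaf R G X) (V : Set Y) :
    (p.pushforwardObj E).sections V ≃ₗ[R] E.fixedSections p.hom.ker (p.map ⁻¹' V) where
  toFun t := ⟨fun x => (t.1 ⟨p.map x, x.2⟩).1 ⟨x, rfl⟩, by
      change Continuous _
      rw [continuous_iff_continuousAt]
      intro x₀
      let y₀ : V := ⟨p.map x₀, x₀.2⟩
      let U : Set (p.map ⁻¹' V) := {x | p.map x = y₀}
      have hU : IsOpen U := (isOpen_discrete ({(y₀ : Y)} : Set Y)).preimage
        (p.continuous_map.comp continuous_subtype_val)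
      refine ContinuousOn.continuousAt ?_ (hU.mem_nhds rfl)
      rw [continuousOn_iff_continuous_domRestrict]
      have hc := (t.1 y₀).2.1.comp (f := fun x : U => (⟨x.1.1, x.2⟩ : p.map ⁻¹' {(y₀ : Y)}))
        (Continuous.subtype_mk (continuous_subtype_val.comp continuous_subtype_val) _)
      refine hc.congr ?_
      rintro ⟨x, hx⟩
      have key : ∀ (y : V) (hy : y = y₀) (h : p.map x = y),
          (t.1 y₀).1 ⟨x, h.trans (congrArg _ hy)⟩ = (t.1 y).1 ⟨x, h⟩ := by
        rintro y rfl h; rfl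
      exact congrArg (Sigma.mk x.1) (key ⟨p.map x, x.2⟩ (Subtype.ext hx) rfl), by
      intro n hn x x' h
      have hp : p.map x = p.map x' := by
        rw [← h, p.equivariant, MonoidHom.mem_ker.1 hn, one_smul]
      have key : ∀ (y : V) (hy : ⟨p.map x, x.2⟩ = y) (h' : p.map x' = y),
          (t.1 ⟨p.map x, x.2⟩).1 ⟨x', hp.symm⟩ = (t.1 y).1 ⟨x', h'⟩ := by
        rintro y rfl h'; rfl
      exact ((t.1 ⟨p.map x, x.2⟩).2.2 n hn ⟨x, rfl⟩ ⟨x', hp.symm⟩ h).trans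
        (key ⟨p.map x', x'.2⟩ (Subtype.ext hp) rfl)⟩
  map_add' _ _ := rfl
  map_smul' _ _ := rfl
  invFun s :=
    have hV : ∀ (y : V) (x : p.map ⁻¹' {(y : Y)}), (x : X) ∈ p.map ⁻¹' V := fun y x => by
      have hx : p.map x = y := x.2
      simp [hx]
    ⟨fun y => ⟨fun x => s.1 ⟨x, hV y x⟩,
      s.2.1.comp (Continuous.subtype_mk continuous_subtype_val _),
      fun n hn x x' h => s.2.2 n hn ⟨x, hV y x⟩ ⟨x', hV y x'⟩ h⟩,
      continuous_of_discreteTopology⟩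
  left_inv t := by
    refine Subtype.ext (funext fun y => Subtype.ext (funext fun x => ?_))
    have key : ∀ (y' : V) (hy : y' = y) (h : p.map x = y'),
        (t.1 y').1 ⟨x, h⟩ = (t.1 y).1 x := by
      rintro y' rfl h; rfl
    exact key ⟨p.map x, _⟩ (Subtype.ext x.2) rfl
  right_inv s := rfl

theorem pushforward_act_apply (p : ChangeMap G X H Y) (E : GSheaf R G X) (g : G) (h : H)
    (hg : p.hom g = h) {y y' : Y} (hy : h • y = y') (s : (p.pushforwardObj E).stalk y)
    (x : p.map ⁻¹' {y}) (x' : p.map ⁻¹' {y'}) (hx : g • (x : X) = x') :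
    ((p.pushforwardObj E).act h hy s).1 x' = E.act g hx (s.1 x) :=
  p.translate_apply E _ (p.surjInv_smul hy) s g (by rw [Function.surjInv_eq p.surjective_hom, hg]) x x' hx

theorem pushforward_cast_apply (p : ChangeMap G X H Y) (E : GSheaf R G X) {y y' : Y} (hy : y = y')
    (s : (p.pushforwardObj E).stalk y) (x : p.map ⁻¹' {y'}) :
    ((p.pushforwardObj E).cast hy s).1 x = s.1 ⟨x, hy ▸ x.2⟩ := by
  subst hy; simp

/-- The functor `p̄_*`. -/
noncomputable def pushforward (R : Type u) [Ring R] (p : ChangeMap G X H Y) : GSheaf R G X ⥤ GSheaf R H Y where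
  obj E := p.pushforwardObj E
  map {E E'} f :=
    { app := fun y =>
        { toFun := fun s => ⟨fun x => f.app x (s.1 x), f.continuous_app.comp s.2.1,
            fun n hn x x' h => by rw [← f.app_act, s.2.2 n hn x x' h]⟩
          map_add' := fun s t => Subtype.ext (funext fun x => map_add _ _ _)
          map_smul' := fun r s => Subtype.ext (funext fun x => map_smul _ _ _) }
      app_act := fun h y y' hy s => by
        refine Subtype.ext (funext fun x => ?_)
        exact f.app_act _ _ _
      continuous_app := continuous_of_discreteTopology }

/-- The section `x ↦ α (x, d)` over the fibre of `y` which is adjoint to `α : p̄^* D ⟶ E`. -/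
def transposeFun (p : ChangeMap G X H Y) {D : GSheaf R H Y} {E : GSheaf R G X}
    (α : (pullback R p).obj D ⟶ E) (y : Y) :
    D.stalk y →ₗ[R] E.fixedSections p.hom.ker (p.map ⁻¹' {y}) where
  toFun d := ⟨fun x => α.app x (D.cast x.2.symm d : D.stalk (p.map x)), by
      refine α.continuous_app.comp (f := fun x : p.map ⁻¹' {y} =>
        (⟨x, D.cast x.2.symm d⟩ : (p.pullbackObj D).Total)) ?_
      refine p.continuous_to_pullback D continuous_subtype_val ?_
      exact (continuous_const (y := (⟨y, d⟩ : D.Total))).congr fun x => (D.mk_cast _ _).symm, by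
      intro n hn x x' h
      have hx : p.map x = y := x.2
      have hx' : p.map x' = y := x'.2
      have h' := p.app_act_of_pullback α n h (p.smul_map_of_smul h) (D.cast hx.symm d)
      refine h'.symm.trans (congrArg (α.app x') ?_)
      rw [D.act_congr (MonoidHom.mem_ker.1 hn) _ (by rw [one_smul, hx, hx'])]
      exact D.cast_cast hx.symm (hx.trans hx'.symm) d⟩
  map_add' d d' := Subtype.ext (funext fun x =>
    (congrArg (α.app x) (map_add (D.cast _) d d')).trans (map_add (α.app x) _ _))
  map_smul' r d := Subtype.ext (funext fun x =>
    (congrArg (α.app x) (map_smul (D.cast _) r d)).trans (map_smul (α.app x) _ _))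

/-- The bijection `Hom (p̄^* D, E) ≃ Hom (D, p̄_* E)`. -/
noncomputable def homEquiv (p : ChangeMap G X H Y) (D : GSheaf R H Y) (E : GSheaf R G X) :
    ((pullback R p).obj D ⟶ E) ≃ (D ⟶ (pushforward R p).obj E) where
  toFun α :=
    { app := fun y => p.transposeFun α y
      app_act := fun h y y' hy d => by
        obtain ⟨g, rfl⟩ := p.surjective_hom h
        refine Subtype.ext (funext fun x' => ?_)
        have hx' : p.map x' = y' := x'.2
        have hx : p.map (g⁻¹ • (x' : X)) = y := p.smul_mem_fibre hy x'
        refine Eq.trans ?_ (p.pushforward_act_apply E g _ rfl hy (p.transposeFun α y d)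
          ⟨g⁻¹ • (x' : X), hx⟩ x' (smul_inv_smul _ _)).symm
        refine Eq.trans ?_ (p.app_act_of_pullback α g (smul_inv_smul _ _)
          (p.smul_map_of_smul (smul_inv_smul _ _)) (D.cast hx.symm d))
        refine congrArg (α.app x') ?_
        rw [D.act_cast, D.cast_act]
      continuous_app := by
        have : DiscreteTopology D.Total := D.isLocalHomeomorph.comap_discreteTopology
        exact continuous_of_discreteTopology }
  invFun β :=
    { app := fun x =>
        { toFun := fun (d : D.stalk (p.map x)) => (β.app (p.map x) d).1 ⟨x, rfl⟩
          map_add' := fun d d' => congrFun (congrArg Subtype.val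
            (map_add (β.app (p.map x)) d d')) ⟨x, rfl⟩
          map_smul' := fun r d => congrFun (congrArg Subtype.val
            (map_smul (β.app (p.map x)) r d)) ⟨x, rfl⟩ }
      app_act := fun g x x' h d => by
        refine (congrFun (congrArg Subtype.val
          (β.app_act (p.hom g) (p.smul_map_of_smul h) d)) ⟨x', rfl⟩).trans ?_
        exact p.pushforward_act_apply E g _ rfl (p.smul_map_of_smul h) (β.app (p.map x) d)
          ⟨x, rfl⟩ ⟨x', rfl⟩ h
      continuous_app := p.continuous_of_fibre (fun y d => β.app y d) }
  left_inv α := by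
    ext x d
    exact congrArg (α.app x) (D.cast_rfl _ _)
  right_inv β := by
    ext y d
    refine Subtype.ext (funext fun x => ?_)
    obtain ⟨x, rfl⟩ := x
    exact congrArg (fun d => (β.app (p.map x) d).1 ⟨x, rfl⟩) (D.cast_rfl _ _)

/-- The adjunction `p̄^* ⊣ p̄_*`. -/
noncomputable def adj (R : Type u) [Ring R] (p : ChangeMap G X H Y) :
    pullback R p ⊣ pushforward R p :=
  Adjunction.mkOfHomEquiv
    { homEquiv := p.homEquiv
      homEquiv_naturality_left_symm := fun f g => by
        ext x d
        rfl
      homEquiv_naturality_right := fun f g => by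
        ext y d
        rfl }

end

section

variable {R : Type u} [Ring R]
  {G : Type u} [Group G] [TopologicalSpace G]
  {X : Type u} [TopologicalSpace X] [MulAction G X] [ContinuousSMul G X]
  {H : Type u} [Group H] [TopologicalSpace H]
  {Y : Type u} [TopologicalSpace Y] [MulAction H Y] [ContinuousSMul H Y]
  {K : Type u} [Group K] [TopologicalSpace K]
  {Z : Type u} [TopologicalSpace Z] [MulAction K Z]

/-- The canonical identification `p̄^* D ⟶ D` if `p` is the identity. -/
def pullbackId (p : ChangeMap G X G X) (hhom : ∀ g, p.hom g = g) (hmap : ∀ x, p.map x = x)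
    (D : GSheaf R G X) : (pullback R p).obj D ⟶ D where
  app x := D.cast (hmap x)
  app_act g x x' h d := by
    refine (D.cast_act (p.smul_map_of_smul h) (hmap x') d).trans ?_
    refine Eq.trans ?_ (D.act_cast (hmap x) h d).symm
    exact D.act_congr (hhom g) _ _ _
  continuous_app := (continuous_snd.comp (p.pullback_continuous D)).congr
    fun q => (D.mk_cast _ _).symm

/-- The canonical identification `r̄^* D ⟶ p̄^* (q̄^* D)` if `r` is the composite of `p` and `q`. -/
def pullbackComp (p : ChangeMap G X H Y) (q : ChangeMap H Y K Z) (r : ChangeMap G X K Z)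
    (hhom : ∀ g, r.hom g = q.hom (p.hom g)) (hmap : ∀ x, r.map x = q.map (p.map x))
    (D : GSheaf R K Z) :
    (pullback R r).obj D ⟶ (pullback R p).obj ((pullback R q).obj D) where
  app x := D.cast (hmap x)
  app_act g x x' h d := by
    refine (D.cast_act (r.smul_map_of_smul h) (hmap x') d).trans ?_
    refine Eq.trans ?_ (D.act_cast (hmap x)
      (q.smul_map_of_smul (p.smul_map_of_smul h)) d).symm
    exact D.act_congr (hhom g) _ _ _
  continuous_app := by
    have h1 := continuous_fst.comp (r.pullback_continuous D)
    refine p.continuous_to_pullback _ h1 ?_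
    refine q.continuous_to_pullback _ (p.continuous_map.comp h1) ?_
    exact (continuous_snd.comp (r.pullback_continuous D)).congr
      fun t => (D.mk_cast _ _).symm

variable [DiscreteTopology H] [DiscreteTopology Y] [DiscreteTopology K] [DiscreteTopology Z]

/-- The canonical identification `r̄_* E ⟶ q̄_* (p̄_* E)` if `r` is the composite of `p` and `q`:
it sends a section `s` over the fibre `r⁻¹ {z}` to the family of its restrictions to the fibres
`p⁻¹ {y}` with `q y = z`. -/
noncomputable def pushforwardComp (p : ChangeMap G X H Y) (q : ChangeMap H Y K Z)
    (r : ChangeMap G X K Z)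
    (hhom : ∀ g, r.hom g = q.hom (p.hom g)) (hmap : ∀ x, r.map x = q.map (p.map x))
    (E : GSheaf R G X) :
    (pushforward R r).obj E ⟶ (pushforward R q).obj ((pushforward R p).obj E) :=
  have hfib : ∀ {z : Z} (y : q.map ⁻¹' {z}) (x : p.map ⁻¹' {(y : Y)}),
      (x : X) ∈ r.map ⁻¹' {z} := fun {z} y x => by
    have hx : p.map x = y := x.2
    have hy : q.map y = z := y.2
    simp [hmap, hx, hy]
  have hker : ∀ g, p.hom g ∈ q.hom.ker → g ∈ r.hom.ker := fun g hg => by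
    rw [MonoidHom.mem_ker] at hg ⊢
    rw [hhom, hg]
  { app := fun z =>
      { toFun := fun (s : E.fixedSections r.hom.ker (r.map ⁻¹' {z})) =>
          ⟨fun y => ⟨fun x => s.1 ⟨x, hfib y x⟩,
            s.2.1.comp (Continuous.subtype_mk continuous_subtype_val _),
            fun n hn x x' h => s.2.2 n (hker n (by
              rw [MonoidHom.mem_ker.1 hn]; exact one_mem _)) ⟨x, hfib y x⟩ ⟨x', hfib y x'⟩ h⟩,
          continuous_of_discreteTopology, fun n hn y y' h => by
            obtain ⟨g, rfl⟩ := p.surjective_hom n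
            refine Subtype.ext (funext fun x' => ?_)
            refine (p.pushforward_act_apply E g _ rfl h _
              ⟨g⁻¹ • (x' : X), p.smul_mem_fibre h x'⟩ x' (smul_inv_smul _ _)).trans ?_
            exact s.2.2 g (hker g hn) ⟨_, hfib y ⟨_, p.smul_mem_fibre h x'⟩⟩ ⟨x', hfib y' x'⟩
              (smul_inv_smul _ _)⟩
        map_add' := fun s t => rfl
        map_smul' := fun c s => rfl }
    app_act := fun k z z' h s => by
      obtain ⟨g, rfl⟩ := r.surjective_hom k
      refine Subtype.ext (funext fun y' => Subtype.ext (funext fun x' => ?_))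
      have h' : q.hom (p.hom g) • z = z' := by rw [← hhom, h]
      have hy := q.smul_mem_fibre h' y'
      have hx := p.smul_mem_fibre (smul_inv_smul (p.hom g) (y' : Y)) x'
      refine (r.pushforward_act_apply E g _ rfl h s ⟨g⁻¹ • (x' : X), hfib ⟨_, hy⟩ ⟨_, hx⟩⟩
        ⟨x', hfib y' x'⟩ (smul_inv_smul _ _)).trans ?_
      symm
      refine (congrFun (congrArg Subtype.val (q.pushforward_act_apply (p.pushforwardObj E)
        (p.hom g) _ (hhom g).symm h _ ⟨_, hy⟩ y' (smul_inv_smul _ _))) x').trans ?_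
      exact p.pushforward_act_apply E g _ rfl _ _ ⟨g⁻¹ • (x' : X), hx⟩ x' (smul_inv_smul _ _)
    continuous_app := by
      have : DiscreteTopology ((pushforward R r).obj E).Total :=
        inferInstanceAs (DiscreteTopology (r.pushforwardObj E).Total)
      exact continuous_of_discreteTopology }

end

end ChangeMap

/-! ### Diagrams of finite groups acting on finite spaces -/

/-- A diagram of finite discrete groups `G i` and surjective homomorphisms, and of finite discrete
`G i`-spaces `X i` and surjective equivariant maps, indexed by the category `I`. -/
structure FiniteDiagram (I : Type u) [SmallCategory I] where
  G : I → Type u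
  X : I → Type u
  [group : ∀ i, Group (G i)]
  [topG : ∀ i, TopologicalSpace (G i)]
  [topX : ∀ i, TopologicalSpace (X i)]
  [discreteG : ∀ i, DiscreteTopology (G i)]
  [discreteX : ∀ i, DiscreteTopology (X i)]
  [finiteG : ∀ i, Finite (G i)]
  [finiteX : ∀ i, Finite (X i)]
  [mulAction : ∀ i, MulAction (G i) (X i)]
  mapG {i j : I} (f : i ⟶ j) : G i →* G j
  mapX {i j : I} (f : i ⟶ j) : X i → X j
  mapG_id (i : I) (g : G i) : mapG (𝟙 i) g = g
  mapG_comp {i j k : I} (f : i ⟶ j) (f' : j ⟶ k) (g : G i) : mapG (f ≫ f') g = mapG f' (mapG f g)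
  mapX_id (i : I) (x : X i) : mapX (𝟙 i) x = x
  mapX_comp {i j k : I} (f : i ⟶ j) (f' : j ⟶ k) (x : X i) : mapX (f ≫ f') x = mapX f' (mapX f x)
  surjective_mapG {i j : I} (f : i ⟶ j) : Function.Surjective (mapG f)
  surjective_mapX {i j : I} (f : i ⟶ j) : Function.Surjective (mapX f)
  mapX_smul {i j : I} (f : i ⟶ j) (g : G i) (x : X i) : mapX f (g • x) = mapG f g • mapX f x

attribute [instance] FiniteDiagram.group FiniteDiagram.topG FiniteDiagram.topX
  FiniteDiagram.discreteG FiniteDiagram.discreteX FiniteDiagram.finiteG FiniteDiagram.finiteX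
  FiniteDiagram.mulAction

namespace FiniteDiagram

section

variable {I : Type u} [SmallCategory I] (S : FiniteDiagram I)

instance (i : I) : ContinuousSMul (S.G i) (S.X i) := ⟨continuous_of_discreteTopology⟩

/-- The equivariant map `φ_f : X i → X j` along `φ_f^G : G i → G j`. -/
def change {i j : I} (f : i ⟶ j) : ChangeMap (S.G i) (S.X i) (S.G j) (S.X j) where
  hom := S.mapG f
  map := S.mapX f
  continuous_hom := continuous_of_discreteTopology
  surjective_hom := S.surjective_mapG f
  continuous_map := continuous_of_discreteTopology
  equivariant := S.mapX_smul f

/-- The limit `G` of the groups `G i`, as a subgroup of the product, with the subspace topology. -/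
def limG : Subgroup ((i : I) → S.G i) where
  carrier := {g | ∀ ⦃i j : I⦄ (f : i ⟶ j), S.mapG f (g i) = g j}
  one_mem' := fun _ _ _ => map_one _
  mul_mem' := fun ha hb i j f => by simp [ha f, hb f]
  inv_mem' := fun ha i j f => by simp [ha f]

/-- The limit `X` of the spaces `X i`, as a subspace of the product. -/
abbrev limX : Type u := {x : (i : I) → S.X i // ∀ ⦃i j : I⦄ (f : i ⟶ j), S.mapX f (x i) = x j}

instance : MulAction S.limG S.limX where
  smul g x := ⟨fun i => g.1 i • x.1 i, fun i j f => by rw [S.mapX_smul, g.2 f, x.2 f]⟩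
  one_smul x := Subtype.ext (funext fun i => one_smul _ _)
  mul_smul g k x := Subtype.ext (funext fun i => mul_smul _ _ _)

theorem smul_apply (g : S.limG) (x : S.limX) (i : I) : (g • x).1 i = g.1 i • x.1 i := rfl

instance : ContinuousSMul S.limG S.limX where
  continuous_smul := by
    refine Continuous.subtype_mk (continuous_pi fun i => ?_) _
    exact ((continuous_apply i).comp (continuous_subtype_val.comp continuous_fst)).smul
      ((continuous_apply i).comp (continuous_subtype_val.comp continuous_snd))

theorem surjective_projG [IsCofiltered I] (i : I) :
    Function.Surjective fun g : S.limG => g.1 i := by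
  let F : I ⥤ Type u :=
    { obj := S.G
      map := fun f => TypeCat.ofHom (S.mapG f)
      map_id := fun i => by ext g; exact S.mapG_id i g
      map_comp := fun f f' => by ext g; exact S.mapG_comp f f' g }
  have : ∀ j, Nonempty (F.obj j) := fun j => ⟨(1 : S.G j)⟩
  have : ∀ j, Finite (F.obj j) := fun j => S.finiteG j
  intro g
  obtain ⟨s, hs⟩ := F.eval_section_surjective_of_surjective
    (fun i j f => S.surjective_mapG f) i g
  exact ⟨⟨s.1, fun i j f => s.2 f⟩, hs⟩

/-- The projections `p_i^G : G → G i` and `p_i : X → X i`. -/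
def proj [IsCofiltered I] (i : I) : ChangeMap S.limG S.limX (S.G i) (S.X i) where
  hom := (Pi.evalMonoidHom S.G i).comp S.limG.subtype
  map x := x.1 i
  continuous_hom := (continuous_apply i).comp continuous_subtype_val
  surjective_hom := S.surjective_projG i
  continuous_map := (continuous_apply i).comp continuous_subtype_val
  equivariant _ _ := rfl

end

end FiniteDiagram

/-! ### `G_•`-sheaves -/

/-- A `G_•`-sheaf of `R`-modules over `X_•`: a `G i`-sheaf `D i` over `X i` for each `i` and a map
`α_f : φ̄_f^* D_j ⟶ D_i` of `G i`-sheaves for each `f : i ⟶ j`, functorially in `f`. -/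
structure DiagramSheaf (R : Type u) [Ring R] {I : Type u} [SmallCategory I]
    (S : FiniteDiagram I) where
  obj (i : I) : GSheaf R (S.G i) (S.X i)
  str {i j : I} (f : i ⟶ j) : (ChangeMap.pullback R (S.change f)).obj (obj j) ⟶ obj i
  str_id (i : I) :
    str (𝟙 i) = ChangeMap.pullbackId (S.change (𝟙 i)) (S.mapG_id i) (S.mapX_id i) (obj i)
  str_comp {i j k : I} (f : i ⟶ j) (f' : j ⟶ k) :
    str (f ≫ f') =
      ChangeMap.pullbackComp (S.change f) (S.change f') (S.change (f ≫ f'))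
        (S.mapG_comp f f') (S.mapX_comp f f') (obj k) ≫
      (ChangeMap.pullback R (S.change f)).map (str f') ≫ str f

namespace DiagramSheaf

section

variable {R : Type u} [Ring R] {I : Type u} [SmallCategory I] {S : FiniteDiagram I}

/-- A map of `G_•`-sheaves. -/
@[ext]
structure Hom (D D' : DiagramSheaf R S) where
  app (i : I) : D.obj i ⟶ D'.obj i
  comm {i j : I} (f : i ⟶ j) :
    (ChangeMap.pullback R (S.change f)).map (app j) ≫ D'.str f = D.str f ≫ app i

instance : Category (DiagramSheaf R S) where
  Hom := Hom
  id D := ⟨fun i => 𝟙 _, fun f => by simp⟩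
  comp a b := ⟨fun i => a.app i ≫ b.app i, fun f => by
    rw [Functor.map_comp, Category.assoc, b.comm, ← Category.assoc, a.comm, Category.assoc]⟩

@[ext]
theorem hom_ext {D D' : DiagramSheaf R S} {a b : D ⟶ D'} (h : ∀ i, a.app i = b.app i) : a = b :=
  Hom.ext (funext h)

/-- The adjoint structure map `ᾱ_f : D_j ⟶ (φ̄_f)_* D_i`. -/
noncomputable def adjointStr (D : DiagramSheaf R S) {i j : I} (f : i ⟶ j) :
    D.obj j ⟶ (ChangeMap.pushforward R (S.change f)).obj (D.obj i) :=
  ((ChangeMap.adj R (S.change f)).homEquiv _ _) (D.str f)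

/-- The property that all adjoint structure maps are isomorphisms. -/
def IsLocal (R : Type u) [Ring R] (S : FiniteDiagram I) : ObjectProperty (DiagramSheaf R S) :=
  fun D => ∀ ⦃i j : I⦄ (f : i ⟶ j), IsIso (D.adjointStr f)

theorem str_id_app (D : DiagramSheaf R S) (i : I) (x : S.X i)
    (d : (D.obj i).stalk (S.mapX (𝟙 i) x)) :
    (D.str (𝟙 i)).app x d = (D.obj i).cast (S.mapX_id i x) d := by
  rw [D.str_id]; rfl

theorem str_comp_app (D : DiagramSheaf R S) {i j k : I} (f : i ⟶ j) (f' : j ⟶ k) (x : S.X i)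
    (d : (D.obj k).stalk (S.mapX (f ≫ f') x)) :
    (D.str (f ≫ f')).app x d = (D.str f).app x ((D.str f').app (S.mapX f x)
      ((D.obj k).cast (S.mapX_comp f f' x) d : (D.obj k).stalk (S.mapX f' (S.mapX f x)))) := by
  rw [D.str_comp]; rfl

/-- Naturality of structure maps with respect to transport. -/
theorem str_cast (D : DiagramSheaf R S) {i j : I} (f : i ⟶ j) {x x' : S.X i} (h : x = x')
    (h' : S.mapX f x = S.mapX f x') (d : (D.obj j).stalk (S.mapX f x)) :
    (D.str f).app x' ((D.obj j).cast h' d : (D.obj j).stalk (S.mapX f x')) =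
      (D.obj i).cast h ((D.str f).app x d) := by
  subst h
  exact (congrArg ((D.str f).app x) ((D.obj j).cast_rfl _ d)).trans ((D.obj i).cast_rfl _ _).symm

variable (R S) [IsCofiltered I]

/-- The diagram `i ↦ p̄_i^* D_i` of `G`-sheaves over `X`, with transition maps
`p̄_j^* D_j = p̄_i^* (φ̄_f^* D_j) ⟶ p̄_i^* D_i` for `f : i ⟶ j`, as a functor of `D`. -/
def pullbackDiagram : DiagramSheaf R S ⥤ (Iᵒᵖ ⥤ GSheaf R S.limG S.limX) where
  obj D :=
    { obj := fun i => (ChangeMap.pullback R (S.proj i.unop)).obj (D.obj i.unop)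
      map := fun {j i} f =>
        ChangeMap.pullbackComp (S.proj i.unop) (S.change f.unop) (S.proj j.unop)
          (fun g => (g.2 f.unop).symm) (fun x => (x.2 f.unop).symm) (D.obj j.unop) ≫
        (ChangeMap.pullback R (S.proj i.unop)).map (D.str f.unop)
      map_id := fun i => by
        ext x d
        have h : x.1 i.unop = S.mapX (𝟙 i.unop) (x.1 i.unop) := (S.mapX_id _ _).symm
        refine (D.str_id_app i.unop (x.1 i.unop) ((D.obj i.unop).cast h d)).trans ?_
        exact ((D.obj i.unop).cast_cast h (S.mapX_id _ _) d).trans ((D.obj i.unop).cast_rfl _ d)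
      map_comp := fun {k j i} f' f => by
        ext x d
        have hf : x.1 j.unop = S.mapX f.unop (x.1 i.unop) := (x.2 f.unop).symm
        have hf' : x.1 k.unop = S.mapX f'.unop (x.1 j.unop) := (x.2 f'.unop).symm
        have hff : x.1 k.unop = S.mapX (f.unop ≫ f'.unop) (x.1 i.unop) := (x.2 _).symm
        refine (D.str_comp_app f.unop f'.unop (x.1 i.unop) ((D.obj k.unop).cast hff d)).trans ?_
        refine congrArg ((D.str f.unop).app (x.1 i.unop)) ?_
        refine Eq.trans ?_ (D.str_cast f'.unop hf (congrArg _ hf) ((D.obj k.unop).cast hf' d))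
        refine congrArg ((D.str f'.unop).app (S.mapX f.unop (x.1 i.unop))) ?_
        exact ((D.obj k.unop).cast_cast hff _ d).trans ((D.obj k.unop).cast_cast hf' _ d).symm }
  map {D D'} a :=
    { app := fun i => (ChangeMap.pullback R (S.proj i.unop)).map (a.app i.unop)
      naturality := fun {j i} f => by
        ext x d
        have hf : x.1 j.unop = S.mapX f.unop (x.1 i.unop) := (x.2 f.unop).symm
        refine (congrArg (fun b => GSheaf.Hom.app b (x.1 i.unop)
          ((D.obj j.unop).cast hf d : (D.obj j.unop).stalk _)) (a.comm f.unop)).symm.trans ?_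
        exact congrArg ((D'.str f.unop).app (x.1 i.unop))
          (GSheaf.Hom.app_cast (a.app j.unop) hf d) }

/-- The functor `p̄_•`, which sends a `G`-sheaf `E` over `X` to the sheaves `(p̄_i)_* E`, with
structure maps adjoint to `(p̄_j)_* E = (φ̄_f)_* (p̄_i)_* E`. -/
noncomputable def pushforwardDiagram : GSheaf R S.limG S.limX ⥤ DiagramSheaf R S where
  obj E :=
    { obj := fun i => (ChangeMap.pushforward R (S.proj i)).obj E
      str := fun {i j} f => ((ChangeMap.adj R (S.change f)).homEquiv _ _).symm
        (ChangeMap.pushforwardComp (S.proj i) (S.change f) (S.proj j)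
          (fun g => (g.2 f).symm) (fun x => (x.2 f).symm) E)
      str_id := fun i => by
        ext x s
        refine Subtype.ext (funext fun z => ?_)
        exact ((S.proj i).pushforward_cast_apply E (S.mapX_id i x) s z).symm
      str_comp := fun {i j k} f f' => by
        ext x s
        refine Subtype.ext (funext fun z => ?_)
        have hz : z.1.1 i = x := z.2
        have hz' : S.mapX f x = z.1.1 j := (congrArg _ hz.symm).trans (z.1.2 f)
        exact ((S.proj k).pushforward_cast_apply E (S.mapX_comp f f' x) s
          ⟨z, (z.1.2 f').symm.trans (congrArg _ hz'.symm)⟩).symm }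
  map {E E'} a :=
    { app := fun i => (ChangeMap.pushforward R (S.proj i)).map a
      comm := fun f => by
        ext x s
        rfl }

end

end DiagramSheaf

end EquivariantSheaf

open EquivariantSheaf

/-! A filtered colimit of sheaf spaces can be formed stalk by stalk. The transition maps are local
homeomorphisms, so the final topology on the union of the colimit stalks is again that of a sheaf
space (`colim_isLocalHomeomorph`), and operations represented at a single stage stay continuous
(`filteredColimit`). By the adjunctions `p̄_i^* ⊣ (p̄_i)_*` at each level, a map `D ⟶ p̄_• E` is the
same thing as a cocone from the diagram of the `p̄_i^* D_i` to `E` (`coconeEquiv`), and this gives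
the adjunction `colimAdj`.

Isomorphisms can then be tested on stalks (`isIso_of_bijective`), using that the fibres of the
projections `p_i` through a point of the limit form a basis of neighbourhoods. For the counit, an
element of the colimit stalk at `x` is represented by a `ker p_i^G`-fixed section over the fibre of
`p_i` through `x`, and the counit evaluates it at `x`. Sections that agree at `x` agree on a smaller
fibre, hence injectivity. Any `e` over `x` extends to a section near `x`, and continuity of the
action makes it fixed by some `ker p_k^G` on a small enough fibre, hence surjectivity.

For the unit at a local `D`, each point of the limit over `y : X i` gives the required information
at a stage depending on that point. The fibre over `y` is compact, so one stage `f : k ⟶ i` serves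
all of it (`exists_uniform`). Bijectivity of the adjoint structure map of `f` then brings the
information on the finite fibre of `X k` over `y` back to the stalk of `D i` at `y`. -/

namespace EquivariantSheaf

/-! ### Maps of sheaf spaces -/

namespace GSheaf

section

variable {R : Type u} [Ring R] {G : Type u} [Group G] [TopologicalSpace G]
  {X : Type u} [TopologicalSpace X] [MulAction G X]

/-- The map of total spaces induced by a map of `G`-sheaves. -/
def Hom.total {E F : GSheaf R G X} (f : E ⟶ F) (e : E.Total) : F.Total := ⟨e.1, f.app e.1 e.2⟩

/-- Both projections to `X` are local homeomorphisms and the map is continuous over `X`. Openness is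
what is mostly used afterwards. -/
theorem Hom.isLocalHomeomorph_total {E F : GSheaf R G X} (f : E ⟶ F) :
    IsLocalHomeomorph (Hom.total f) :=
  IsLocalHomeomorph.of_comp (g := (Sigma.fst : F.Total → X)) (f := Hom.total f)
    E.isLocalHomeomorph F.isLocalHomeomorph f.continuous_app

theorem continuous_proj (E : GSheaf R G X) : Continuous (Sigma.fst : E.Total → X) :=
  E.isLocalHomeomorph.continuous

/-- A map of `G`-sheaves which is bijective on stalks is an isomorphism. -/
theorem isIso_of_bijective {E F : GSheaf R G X} (f : E ⟶ F)
    (hf : ∀ x, Function.Bijective (f.app x)) : IsIso f := by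
  let e (x : X) : E.stalk x ≃ₗ[R] F.stalk x := LinearEquiv.ofBijective (f.app x) (hf x)
  have he : ∀ x (a : F.stalk x), f.app x ((e x).symm a) = a := fun x a =>
    (e x).apply_symm_apply a
  have he' : ∀ x (a : E.stalk x), (e x).symm (f.app x a) = a := fun x a =>
    (e x).symm_apply_apply a
  let g : F ⟶ E :=
    { app := fun x => (e x).symm
      app_act := fun k x y h a => by
        apply (hf y).1
        change f.app y ((e y).symm _) = f.app y (E.act k h ((e x).symm a))
        rw [f.app_act, he, he]
      continuous_app := by
        -- The preimage of an open set under the inverse is its image under `f`, and `f` is open on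
        -- total spaces.
        rw [continuous_def]
        intro U hU
        convert (Hom.isLocalHomeomorph_total f).isOpenMap U hU using 1
        ext ⟨x, a⟩
        constructor
        · intro h
          exact ⟨_, h, congrArg (Sigma.mk x) (he x a)⟩
        · rintro ⟨⟨x', b⟩, hb, h⟩
          obtain rfl : x' = x := congrArg Sigma.fst h
          obtain rfl : f.app x' b = a := eq_of_heq (Sigma.mk.inj h).2
          change (⟨x', (e x').symm (f.app x' b)⟩ : E.Total) ∈ U
          rwa [he'] }
  exact ⟨g, hom_ext fun x a => he' x a, hom_ext fun x a => he x a⟩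

/-- Two continuous families of elements of the fibres which agree at a point agree near it. -/
theorem eventually_eq (E : GSheaf R G X) {Z : Type*} [TopologicalSpace Z] {f : Z → X}
    {a b : (z : Z) → E.stalk (f z)} (ha : Continuous fun z => (⟨f z, a z⟩ : E.Total))
    (hb : Continuous fun z => (⟨f z, b z⟩ : E.Total)) {z₀ : Z} (h : a z₀ = b z₀) :
    ∀ᶠ z in 𝓝 z₀, a z = b z := by
  obtain ⟨e, he, hE⟩ := E.isLocalHomeomorph ⟨f z₀, a z₀⟩
  have h1 := ha.continuousAt.preimage_mem_nhds (e.open_source.mem_nhds he)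
  have h2 := hb.continuousAt.preimage_mem_nhds (x := z₀)
    (e.open_source.mem_nhds (by rw [← h]; exact he))
  filter_upwards [h1, h2] with z hz hz'
  have := e.injOn hz hz' (by rw [← hE])
  simpa using this

end

end GSheaf

/-! ### Filtered colimits of `G`-sheaves -/

namespace GSheaf

section

variable {R : Type u} [Ring R] {G : Type u} [Group G] [TopologicalSpace G]
  {X : Type u} [TopologicalSpace X] [MulAction G X]

/-- The stalk at `x`, as a functor to `R`-modules. -/
def stalkFunctor (x : X) : GSheaf R G X ⥤ ModuleCat.{u} R where
  obj E := ModuleCat.of R (E.stalk x)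
  map f := ModuleCat.ofHom (f.app x)

variable {J : Type u} [SmallCategory J] (F : J ⥤ GSheaf R G X)

theorem map_comp_app {i j k : J} (f : i ⟶ j) (g : j ⟶ k) (x : X) (e : (F.obj i).stalk x) :
    (F.map (f ≫ g)).app x e = (F.map g).app x ((F.map f).app x e) := by
  rw [F.map_comp]; rfl

/-- The colimit of the stalks at `x`. -/
noncomputable abbrev colimStalk (x : X) : Type u :=
  (colimit (F ⋙ stalkFunctor x) : ModuleCat.{u} R)

/-- The canonical map to the colimit of the stalks. -/
noncomputable def toColimStalk (j : J) (x : X) : (F.obj j).stalk x →ₗ[R] colimStalk F x :=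
  (colimit.ι (F ⋙ stalkFunctor x) j).hom

theorem toColimStalk_map {i j : J} (f : i ⟶ j) (x : X) (e : (F.obj i).stalk x) :
    toColimStalk F j x ((F.map f).app x e) = toColimStalk F i x e :=
  ConcreteCategory.congr_hom (colimit.w (F ⋙ stalkFunctor x) f) e

theorem exists_toColimStalk [IsFiltered J] {x : X} (c : colimStalk F x) :
    ∃ j e, toColimStalk F j x e = c :=
  Concrete.colimit_exists_rep (F ⋙ stalkFunctor x) c

theorem exists_toColimStalk₂ [IsFiltered J] {x : X} (c c' : colimStalk F x) :
    ∃ j e e', toColimStalk F j x e = c ∧ toColimStalk F j x e' = c' := by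
  obtain ⟨j, e, rfl⟩ := exists_toColimStalk F c
  obtain ⟨k, e', rfl⟩ := exists_toColimStalk F c'
  exact ⟨IsFiltered.max j k, _, _, toColimStalk_map F (IsFiltered.leftToMax j k) x e,
    toColimStalk_map F (IsFiltered.rightToMax j k) x e'⟩

theorem toColimStalk_eq_iff [IsFiltered J] {x : X} {i j : J} (e : (F.obj i).stalk x)
    (e' : (F.obj j).stalk x) : toColimStalk F i x e = toColimStalk F j x e' ↔
      ∃ (k : J) (f : i ⟶ k) (g : j ⟶ k), (F.map f).app x e = (F.map g).app x e' :=
  Concrete.colimit_rep_eq_iff_exists (F ⋙ stalkFunctor x) (i := i) (j := j) e e'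

/-- The natural transformation between stalk functors given by a group element. -/
def actNatTrans (g : G) {x y : X} (h : g • x = y) :
    (stalkFunctor x : GSheaf R G X ⥤ _) ⟶ stalkFunctor y where
  app E := ModuleCat.ofHom (E.act g h)
  naturality E E' f := by
    ext e
    exact (f.app_act g h e).symm

/-- The action on the colimits of the stalks. -/
noncomputable def colimAct (g : G) {x y : X} (h : g • x = y) :
    colimStalk F x →ₗ[R] colimStalk F y :=
  (colimMap (Functor.whiskerLeft F (actNatTrans g h))).hom

theorem colimAct_toColimStalk (g : G) {x y : X} (h : g • x = y) (j : J)
    (e : (F.obj j).stalk x) :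
    colimAct F g h (toColimStalk F j x e) = toColimStalk F j y ((F.obj j).act g h e) :=
  ConcreteCategory.congr_hom (ι_colimMap (Functor.whiskerLeft F (actNatTrans g h)) j) e

/-- The map from a total space to the union of the colimits of the stalks. -/
noncomputable def toColimTotal (j : J) (e : (F.obj j).Total) : Σ x, colimStalk F x :=
  ⟨e.1, toColimStalk F j e.1 e.2⟩

/-- The final topology on the union of the colimits of the stalks. -/
noncomputable abbrev colimTop : TopologicalSpace (Σ x, colimStalk F x) :=
  ⨆ j, TopologicalSpace.coinduced (toColimTotal F j) (F.obj j).top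

theorem continuous_toColimTotal (j : J) : Continuous[_, colimTop F] (toColimTotal F j) :=
  continuous_iff_coinduced_le.2 (le_iSup
    (fun j => TopologicalSpace.coinduced (toColimTotal F j) (F.obj j).top) j)

theorem toColimTotal_map {i j : J} (f : i ⟶ j) (e : (F.obj i).Total) :
    toColimTotal F j (Hom.total (F.map f) e) = toColimTotal F i e :=
  congrArg (Sigma.mk e.1) (toColimStalk_map F f e.1 e.2)

theorem exists_toColimTotal [IsFiltered J] (c : Σ x, colimStalk F x) :
    ∃ j e, toColimTotal F j e = c := by
  obtain ⟨x, c⟩ := c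
  obtain ⟨j, e, rfl⟩ := exists_toColimStalk F c
  exact ⟨j, ⟨x, e⟩, rfl⟩

theorem toColimTotal_eq_iff [IsFiltered J] {i j : J} (e : (F.obj i).Total)
    (e' : (F.obj j).Total) : toColimTotal F i e = toColimTotal F j e' ↔
      ∃ (k : J) (f : i ⟶ k) (g : j ⟶ k), Hom.total (F.map f) e = Hom.total (F.map g) e' := by
  constructor
  · obtain ⟨x, e⟩ := e
    obtain ⟨x', e'⟩ := e'
    intro h
    obtain rfl : x = x' := congrArg Sigma.fst h
    obtain ⟨k, f, g, hk⟩ := (toColimStalk_eq_iff F e e').1 (eq_of_heq (Sigma.mk.inj h).2)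
    exact ⟨k, f, g, congrArg (Sigma.mk x) hk⟩
  · rintro ⟨k, f, g, h⟩
    rw [← toColimTotal_map F f, h, toColimTotal_map]

/-- Two elements become equal in the colimit only if they do so at a common later stage. So the
preimage at stage `k` of the image of an open set is a union of sets obtained by an image and a
preimage along transition maps, which are open and continuous. -/
theorem isOpenMap_toColimTotal [IsFiltered J] (j : J) :
    letI := colimTop F
    IsOpenMap (toColimTotal F j) := by
  let _ := colimTop F
  intro V hV
  refine isOpen_iSup_iff.2 fun k => isOpen_coinduced.2 ?_
  have : toColimTotal F k ⁻¹' (toColimTotal F j '' V) =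
      ⋃ (l : J) (f : j ⟶ l) (g : k ⟶ l),
        Hom.total (F.map g) ⁻¹' (Hom.total (F.map f) '' V) := by
    ext e
    simp only [Set.mem_preimage, Set.mem_image, Set.mem_iUnion, toColimTotal_eq_iff]
    constructor
    · rintro ⟨v, hv, l, f, g, h⟩
      exact ⟨l, f, g, v, hv, h⟩
    · rintro ⟨l, f, g, v, hv, h⟩
      exact ⟨v, hv, l, f, g, h⟩
  rw [this]
  exact isOpen_iUnion fun l => isOpen_iUnion fun f => isOpen_iUnion fun g =>
    ((Hom.isLocalHomeomorph_total (F.map f)).isOpenMap V hV).preimage (F.map g).continuous_app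

/-- A slice on which the projection from stage `j` is injective has open image in the colimit, and
the projection is still injective on that image. -/
theorem colim_isLocalHomeomorph [IsFiltered J] :
    letI := colimTop F
    IsLocalHomeomorph (Sigma.fst : (Σ x, colimStalk F x) → X) := by
  let _ := colimTop F
  have hfst : Continuous (Sigma.fst : (Σ x, colimStalk F x) → X) :=
    continuous_iSup_dom.2 fun j => continuous_coinduced_dom.2 (F.obj j).continuous_proj
  have hopen : IsOpenMap (Sigma.fst : (Σ x, colimStalk F x) → X) := by
    intro U hU
    have : Sigma.fst '' U = ⋃ j, Sigma.fst '' (toColimTotal F j ⁻¹' U) := by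
      ext x
      simp only [Set.mem_image, Set.mem_iUnion]
      constructor
      · rintro ⟨c, hc, rfl⟩
        obtain ⟨j, e, rfl⟩ := exists_toColimTotal F c
        exact ⟨j, e, hc, rfl⟩
      · rintro ⟨j, e, he, rfl⟩
        exact ⟨_, he, rfl⟩
    rw [this]
    exact isOpen_iUnion fun j => (F.obj j).isLocalHomeomorph.isOpenMap _
      (hU.preimage (continuous_toColimTotal F j))
  rw [isLocalHomeomorph_iff_isOpenEmbedding_restrict]
  intro c
  obtain ⟨j, e, rfl⟩ := exists_toColimTotal F c
  obtain ⟨φ, hφ, hφ'⟩ := (F.obj j).isLocalHomeomorph e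
  have hW := isOpenMap_toColimTotal F j _ φ.open_source
  refine ⟨_, hW.mem_nhds ⟨e, hφ, rfl⟩, ?_⟩
  refine IsOpenEmbedding.of_continuous_injective_isOpenMap
    (hfst.comp continuous_subtype_val) ?_ (hopen.comp hW.isOpenMap_subtype_val)
  rintro ⟨_, v, hv, rfl⟩ ⟨_, v', hv', rfl⟩ h
  have hvv : v = v' := φ.injOn hv hv' (by rw [← hφ']; exact h)
  subst hvv
  rfl

/-- The colimit of a filtered diagram of `G`-sheaves. -/
noncomputable def filteredColimit [IsFiltered J] : GSheaf R G X :=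
  letI := colimTop F
  { stalk := colimStalk F
    act := colimAct F
    act_one := fun {x} h c => by
      obtain ⟨j, e, rfl⟩ := exists_toColimStalk F c
      rw [colimAct_toColimStalk, act_one]
    act_mul := fun g k {x y z} hk hg hgk c => by
      obtain ⟨j, e, rfl⟩ := exists_toColimStalk F c
      rw [colimAct_toColimStalk, colimAct_toColimStalk, colimAct_toColimStalk,
        (F.obj j).act_mul g k hk hg]
    isLocalHomeomorph := colim_isLocalHomeomorph F
    continuous_sub := by
      let t : TopologicalSpace (Σ x, colimStalk F x × colimStalk F x) :=
        TopologicalSpace.induced (fun q : (Σ x, colimStalk F x × colimStalk F x) =>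
          ((⟨q.1, q.2.1⟩ : Σ x, colimStalk F x), (⟨q.1, q.2.2⟩ : Σ x, colimStalk F x)))
          inferInstance
      rw [continuous_iff_continuousAt]
      rintro ⟨x, c, c'⟩
      -- Since `J` is filtered, both elements have representatives at one stage, where subtraction
      -- is already continuous. Neighbourhoods at that stage have neighbourhoods as images in the
      -- colimit.
      obtain ⟨j, e, e', rfl, rfl⟩ := exists_toColimStalk₂ F c c'
      intro W hW
      let s : TopologicalSpace (Σ x, (F.obj j).stalk x × (F.obj j).stalk x) :=
        TopologicalSpace.induced (fun q : (Σ x, (F.obj j).stalk x × (F.obj j).stalk x) =>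
          ((⟨q.1, q.2.1⟩ : (F.obj j).Total), (⟨q.1, q.2.2⟩ : (F.obj j).Total))) inferInstance
      have hsub : Continuous (fun q : (Σ x, (F.obj j).stalk x × (F.obj j).stalk x) =>
          toColimTotal F j ⟨q.1, q.2.1 - q.2.2⟩) :=
        (continuous_toColimTotal F j).comp (F.obj j).continuous_sub
      have hW' := hsub.continuousAt.preimage_mem_nhds (x := ⟨x, e, e'⟩) (t := W) (by
        rw [toColimTotal, map_sub]; exact hW)
      obtain ⟨T, hT, hTW⟩ := (mem_nhds_induced _ _ _).1 hW'
      rw [nhds_prod_eq, Filter.mem_prod_iff] at hT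
      obtain ⟨A, hA, B, hB, hAB⟩ := hT
      have hA' := (isOpenMap_toColimTotal F j).image_mem_nhds hA
      have hB' := (isOpenMap_toColimTotal F j).image_mem_nhds hB
      refine (mem_nhds_induced _ _ _).2 ⟨_, prod_mem_nhds hA' hB', ?_⟩
      rintro ⟨z, b, b'⟩ ⟨⟨⟨y, a⟩, ha, h⟩, ⟨⟨y', a'⟩, ha', h'⟩⟩
      obtain rfl : y = z := congrArg Sigma.fst h
      obtain rfl : y' = y := congrArg Sigma.fst h'
      obtain rfl : _ = b := eq_of_heq (Sigma.mk.inj h).2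
      obtain rfl : _ = b' := eq_of_heq (Sigma.mk.inj h').2
      have : toColimTotal F j ⟨y', a - a'⟩ ∈ W :=
        hTW (show (⟨y', a, a'⟩ : Σ x, (F.obj j).stalk x × (F.obj j).stalk x) ∈ _ from
          hAB ⟨ha, ha'⟩)
      rw [toColimTotal, map_sub] at this
      exact this
    continuous_smul := fun r => by
      refine continuous_iSup_dom.2 fun j => continuous_coinduced_dom.2 ?_
      refine ((continuous_toColimTotal F j).comp ((F.obj j).continuous_smul r)).congr fun e => ?_
      exact congrArg (Sigma.mk e.1) (map_smul (toColimStalk F j e.1) r e.2)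
    continuous_act := by
      rw [continuous_iff_continuousAt]
      rintro ⟨g, c⟩
      obtain ⟨j, e, rfl⟩ := exists_toColimTotal F c
      -- A product with `G` need not preserve final topologies, but it preserves open maps. So
      -- continuity at `(g, [e])` can be tested after pulling back to stage `j`.
      have hopen : IsOpenMap (Prod.map id (toColimTotal F j) : G × (F.obj j).Total → _) :=
        IsOpenMap.id.prodMap (isOpenMap_toColimTotal F j)
      have hc := ((continuous_toColimTotal F j).comp (F.obj j).continuous_act).continuousAt
        (x := (g, e))
      refine Filter.Tendsto.mono_left (Filter.tendsto_map'_iff.2 ?_) (hopen.nhds_le (g, e))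
      have hcomp : (fun q : G × (Σ x, colimStalk F x) =>
          (⟨q.1 • q.2.1, colimAct F q.1 rfl q.2.2⟩ : Σ x, colimStalk F x)) ∘
            Prod.map id (toColimTotal F j) =
          toColimTotal F j ∘ fun q : G × (F.obj j).Total =>
            (⟨q.1 • q.2.1, (F.obj j).act q.1 rfl q.2.2⟩ : (F.obj j).Total) := by
        funext q
        exact congrArg (Sigma.mk _) (colimAct_toColimStalk F q.1 rfl j q.2.2)
      rw [hcomp]
      exact Filter.Tendsto.mono_right hc (congrArg 𝓝 (congrFun hcomp (g, e))).ge }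

/-- The colimit cocone of a filtered diagram of `G`-sheaves. -/
noncomputable def filteredCocone [IsFiltered J] : Cocone F where
  pt := filteredColimit F
  ι :=
    { app := fun j =>
        { app := toColimStalk F j
          app_act := fun g _ _ h e => (colimAct_toColimStalk F g h j e).symm
          continuous_app := continuous_toColimTotal F j }
      naturality := fun _ _ f => hom_ext fun x e => toColimStalk_map F f x e }

/-- The map out of the colimit of the stalks given by a cocone. -/
noncomputable def colimStalkDesc (s : Cocone F) (x : X) : colimStalk F x →ₗ[R] s.pt.stalk x :=
  (colimit.desc (F ⋙ stalkFunctor x) ((stalkFunctor x).mapCocone s)).hom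

theorem colimStalkDesc_toColimStalk (s : Cocone F) (j : J) (x : X) (e : (F.obj j).stalk x) :
    colimStalkDesc F s x (toColimStalk F j x e) = (s.ι.app j).app x e :=
  ConcreteCategory.congr_hom (colimit.ι_desc ((stalkFunctor x).mapCocone s) j) e

/-- `filteredCocone` is a colimit cocone. -/
noncomputable def filteredCoconeIsColimit [IsFiltered J] : IsColimit (filteredCocone F) where
  desc s :=
    { app := colimStalkDesc F s
      app_act := fun g x y h c => by
        obtain ⟨j, e, rfl⟩ := exists_toColimStalk F c
        refine (congrArg (colimStalkDesc F s y) (colimAct_toColimStalk F g h j e)).trans ?_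
        refine (colimStalkDesc_toColimStalk F s j y _).trans ?_
        refine ((s.ι.app j).app_act g h e).trans ?_
        exact congrArg (s.pt.act g h) (colimStalkDesc_toColimStalk F s j x e).symm
      continuous_app := by
        refine continuous_iSup_dom.2 fun j => continuous_coinduced_dom.2 ?_
        refine (s.ι.app j).continuous_app.congr fun e => ?_
        exact congrArg (Sigma.mk e.1) (colimStalkDesc_toColimStalk F s j e.1 e.2).symm }
  fac s j := hom_ext fun x e => colimStalkDesc_toColimStalk F s j x e
  uniq s m hm := by
    ext x c
    obtain ⟨j, e, rfl⟩ := exists_toColimStalk F c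
    refine Eq.trans ?_ (colimStalkDesc_toColimStalk F s j x e).symm
    rw [← hm j]
    rfl

instance hasColimitsOfShape_of_isFiltered [IsFiltered J] :
    HasColimitsOfShape J (GSheaf R G X) :=
  ⟨fun F => ⟨⟨_, filteredCoconeIsColimit F⟩⟩⟩

/-- The chosen `colimit F` is only isomorphic to `filteredColimit F`; this and the next lemma carry
the stalkwise description across that isomorphism. -/
theorem colimit_exists_rep [IsFiltered J] {x : X} (c : (colimit F).stalk x) :
    ∃ (j : J) (e : (F.obj j).stalk x), (colimit.ι F j).app x e = c := by
  let φ := (colimit.isColimit F).coconePointUniqueUpToIso (filteredCoconeIsColimit F)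
  obtain ⟨j, e, he⟩ := exists_toColimStalk F (φ.hom.app x c)
  refine ⟨j, e, ?_⟩
  have h : (filteredCocone F).ι.app j ≫ φ.inv = colimit.ι F j :=
    (colimit.isColimit F).comp_coconePointUniqueUpToIso_inv (filteredCoconeIsColimit F) j
  rw [← h]
  refine (congrArg (φ.inv.app x) he).trans ?_
  exact congrArg (fun m : colimit F ⟶ colimit F => m.app x c) φ.hom_inv_id

theorem colimit_exists_of_app_eq [IsFiltered J] {x : X} {j : J} {e e' : (F.obj j).stalk x}
    (h : (colimit.ι F j).app x e = (colimit.ι F j).app x e') :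
    ∃ (k : J) (f : j ⟶ k), (F.map f).app x e = (F.map f).app x e' := by
  let φ := (colimit.isColimit F).coconePointUniqueUpToIso (filteredCoconeIsColimit F)
  have hφ : colimit.ι F j ≫ φ.hom = (filteredCocone F).ι.app j :=
    (colimit.isColimit F).comp_coconePointUniqueUpToIso_hom (filteredCoconeIsColimit F) j
  have key : toColimStalk F j x e = toColimStalk F j x e' := by
    change ((filteredCocone F).ι.app j).app x e = ((filteredCocone F).ι.app j).app x e'
    rw [← hφ, comp_app, comp_app, h]
  obtain ⟨k, f, g, hfg⟩ := (toColimStalk_eq_iff F e e').1 key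
  -- The equality obtained compares images under two possibly different maps `f` and `g`;
  -- coequalising them leaves a single map.
  refine ⟨IsFiltered.coeq f g, f ≫ IsFiltered.coeqHom f g, ?_⟩
  rw [map_comp_app, hfg, ← map_comp_app, ← IsFiltered.coeq_condition, map_comp_app]

end

end GSheaf

end EquivariantSheaf

/-! ### The adjunction, its unit and its counit on germs -/

namespace EquivariantSheaf

namespace DiagramSheaf

section

variable {R : Type u} [Ring R] {I : Type u} [SmallCategory I] [IsCofiltered I]
  {S : FiniteDiagram I}

theorem ι_comp_colimConstAdj_homEquiv_symm {J C : Type*} [Category* J] [Category* C]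
    [HasColimitsOfShape J C] (F : J ⥤ C) (c : C) (τ : F ⟶ (Functor.const J).obj c) (j : J) :
    colimit.ι F j ≫ (colimConstAdj.homEquiv F c).symm τ = τ.app j := by
  have h := Adjunction.homEquiv_unit colimConstAdj F c ((colimConstAdj.homEquiv F c).symm τ)
  rw [Equiv.apply_symm_apply] at h
  exact (congrArg (fun t => t.app j) h).symm

/-- Maps from a `G_•`-sheaf `D` to `p̄_• E` are cocones under the diagram `p̄_i^* D_i` with
vertex `E`. -/
noncomputable def coconeEquiv (D : DiagramSheaf R S) (E : GSheaf R S.limG S.limX) :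
    ((pullbackDiagram R S).obj D ⟶ (Functor.const Iᵒᵖ).obj E) ≃
      (D ⟶ (pushforwardDiagram R S).obj E) where
  toFun τ :=
    { app := fun i => (S.proj i).homEquiv _ _ (τ.app (Opposite.op i))
      comm := fun {i j} f => by
        ext y d
        refine Subtype.ext (funext fun x => ?_)
        obtain ⟨x, rfl⟩ := x
        -- Evaluated at a point `x` of the limit over `y`, compatibility with the structure maps
        -- becomes naturality of the cocone at `f`, up to transport along `x.2 f`.
        have h := congrArg (fun m => GSheaf.Hom.app m x ((D.obj j).cast (x.2 f) d))
          (τ.naturality f.op)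
        refine Eq.trans h.symm ?_
        refine congrArg ((τ.app (Opposite.op i)).app x) ?_
        refine Eq.trans ?_ ((D.obj i).cast_rfl rfl _).symm
        exact congrArg ((D.str f).app (x.1 i)) (((D.obj j).cast_cast (x.2 f) (x.2 f).symm d).trans
          ((D.obj j).cast_rfl _ d)) }
  invFun b :=
    { app := fun i => ((S.proj i.unop).homEquiv _ _).symm (b.app i.unop)
      naturality := fun {j i} f => by
        ext x d
        have h := congrArg (fun m => GSheaf.Hom.app m (x.1 i.unop)
          ((D.obj j.unop).cast (x.2 f.unop).symm d :
            (D.obj j.unop).stalk (S.mapX f.unop (x.1 i.unop)))) (b.comm f.unop)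
        refine Eq.trans (congrFun (congrArg Subtype.val h) ⟨x, rfl⟩).symm ?_
        have h' := GSheaf.Hom.app_cast (b.app j.unop) (x.2 f.unop).symm d
        refine (congrFun (congrArg Subtype.val h') ⟨x, (x.2 f.unop).symm⟩).trans ?_
        exact (S.proj j.unop).pushforward_cast_apply E (x.2 f.unop).symm _
          ⟨x, (x.2 f.unop).symm⟩ }
  left_inv τ := by
    ext i : 2
    exact ((S.proj i.unop).homEquiv _ _).symm_apply_apply _
  right_inv b := by
    ext i : 1
    exact ((S.proj i).homEquiv _ _).apply_symm_apply _

variable (R S) in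
/-- The adjunction between `D ↦ colim p̄_i^* D_i` and `p̄_•`. -/
noncomputable def colimAdj :
    pullbackDiagram R S ⋙ colim ⊣ pushforwardDiagram R S :=
  Adjunction.mkOfHomEquiv
    { homEquiv := fun D E => ((colimConstAdj).homEquiv _ _).trans (coconeEquiv D E)
      homEquiv_naturality_left_symm := fun {D D' E} a b => by
        rw [Equiv.symm_apply_eq]
        simp only [Equiv.trans_apply, Equiv.symm_trans_apply, Functor.comp_map,
          Adjunction.homEquiv_naturality_left, Equiv.apply_symm_apply]
        rw [← Equiv.symm_apply_eq]
        rfl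
      homEquiv_naturality_right := fun {D E E'} a b => by
        simp only [Equiv.trans_apply]
        rw [Adjunction.homEquiv_naturality_right]
        rfl }

/-- The germ at `x` of an element of the stalk of `D i`. -/
noncomputable def germ (D : DiagramSheaf R S) (i : I) (x : S.limX) :
    (D.obj i).stalk (x.1 i) →ₗ[R] (colimit ((pullbackDiagram R S).obj D)).stalk x :=
  (colimit.ι ((pullbackDiagram R S).obj D) (Opposite.op i)).app x

/-- This is the cocone relation of the colimit. The point `y` is kept apart from `x.1 i` because
later it is a point of `X i` given only by an equation. -/
theorem germ_str (D : DiagramSheaf R S) {i j : I} (f : i ⟶ j) (x : S.limX) {y : S.X i}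
    (hy : y = x.1 i) (d : (D.obj j).stalk (S.mapX f y)) (h : S.mapX f y = x.1 j) :
    D.germ i x ((D.obj i).cast hy ((D.str f).app y d)) = D.germ j x ((D.obj j).cast h d) := by
  subst hy
  have hw := congrArg (fun m => GSheaf.Hom.app m x ((D.obj j).cast h d))
    (colimit.w ((pullbackDiagram R S).obj D) f.op)
  refine Eq.trans ?_ hw
  refine congrArg (D.germ i x) (((D.obj i).cast_rfl _ _).trans ?_)
  refine congrArg ((D.str f).app (x.1 i)) ?_
  exact (((D.obj j).cast_cast h h.symm d).trans ((D.obj j).cast_rfl _ d)).symm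

theorem act_germ (D : DiagramSheaf R S) (i : I) (g : S.limG) {x x' : S.limX} (h : g • x = x')
    (h' : g.1 i • x.1 i = x'.1 i) (d : (D.obj i).stalk (x.1 i)) :
    (colimit ((pullbackDiagram R S).obj D)).act g h (D.germ i x d) =
      D.germ i x' ((D.obj i).act (g.1 i) h' d) :=
  ((colimit.ι ((pullbackDiagram R S).obj D) (Opposite.op i)).app_act g h d).symm

theorem exists_germ_eq (D : DiagramSheaf R S) {x : S.limX}
    (c : (colimit ((pullbackDiagram R S).obj D)).stalk x) : ∃ i d, D.germ i x d = c := by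
  obtain ⟨i, d, h⟩ := GSheaf.colimit_exists_rep _ c
  exact ⟨i.unop, d, h⟩

theorem exists_str_eq_zero (D : DiagramSheaf R S) {i : I} {x : S.limX}
    {d : (D.obj i).stalk (x.1 i)} (h : D.germ i x d = 0) : ∃ (k : I) (f : k ⟶ i),
      (D.str f).app (x.1 k) ((D.obj i).cast (x.2 f).symm d : (D.obj i).stalk (S.mapX f _)) = 0 := by
  obtain ⟨k, f, hf⟩ := GSheaf.colimit_exists_of_app_eq ((pullbackDiagram R S).obj D)
    (j := Opposite.op i) (e := d) (e' := 0) (h.trans (map_zero (D.germ i x)).symm)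
  exact ⟨k.unop, f.unop, hf.trans (map_zero _)⟩

/-- The unit is the transpose of the identity of the colimit, so it corresponds to the colimit
cocone, whose components are the germ maps. -/
theorem colimAdj_unit_app (D : DiagramSheaf R S) (i : I) (y : S.X i)
    (d : (D.obj i).stalk y) (x : (S.proj i).map ⁻¹' {y}) :
    ((((colimAdj R S).unit.app D).app i).app y d).1 x =
      D.germ i x ((D.obj i).cast x.2.symm d) := by
  have h : (colimAdj R S).unit.app D = coconeEquiv D _ (colimConstAdj.homEquiv _ _ (𝟙 _)) := by
    simp [colimAdj, Adjunction.mkOfHomEquiv]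
  rw [h]
  have h' : (colimConstAdj.homEquiv ((pullbackDiagram R S).obj D) _ (𝟙 _)).app (Opposite.op i) =
      colimit.ι ((pullbackDiagram R S).obj D) (Opposite.op i) := by
    rw [Adjunction.homEquiv_unit]
    exact Category.comp_id _
  exact congrArg (fun m => GSheaf.Hom.app m (x : S.limX) ((D.obj i).cast x.2.symm d)) h'

/-- On each stage the counit restricts to the counit of `p̄_i^* ⊣ (p̄_i)_*`, which is evaluation of
sections. -/
theorem colimAdj_counit_app (E : GSheaf R S.limG S.limX) (i : I) (x : S.limX)
    (s : ((S.proj i).pushforwardObj E).stalk (x.1 i)) :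
    ((colimAdj R S).counit.app E).app x (((pushforwardDiagram R S).obj E).germ i x s) =
      s.1 ⟨x, rfl⟩ := by
  have h : colimit.ι ((pullbackDiagram R S).obj ((pushforwardDiagram R S).obj E))
      (Opposite.op i) ≫ (colimAdj R S).counit.app E =
      ((coconeEquiv _ E).symm (𝟙 _)).app (Opposite.op i) := by
    simpa [colimAdj, Adjunction.mkOfHomEquiv] using ι_comp_colimConstAdj_homEquiv_symm
      ((pullbackDiagram R S).obj ((pushforwardDiagram R S).obj E)) E
      ((coconeEquiv _ E).symm (𝟙 _)) (Opposite.op i)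
  exact congrArg (fun m => GSheaf.Hom.app m x s) h

end

end DiagramSheaf

end EquivariantSheaf

/-! ### Topology of the limit: small fibres and compactness -/

namespace EquivariantSheaf

namespace FiniteDiagram

section

variable {I : Type u} [SmallCategory I] [IsCofiltered I] (S : FiniteDiagram I)

theorem surjective_projX (i : I) : Function.Surjective fun x : S.limX => x.1 i := by
  let F : I ⥤ Type u :=
    { obj := S.X
      map := fun f => TypeCat.ofHom (S.mapX f)
      map_id := fun i => by ext x; exact S.mapX_id i x
      map_comp := fun f f' => by ext x; exact S.mapX_comp f f' x }
  intro y
  -- The spaces `X j` might be empty in general. Here `y` lifts to an index below both `i` and `j`,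
  -- and the lift maps to `X j`.
  have : ∀ j, Nonempty (F.obj j) := fun j => by
    obtain ⟨z, -⟩ := S.surjective_mapX (IsCofiltered.minToLeft i j) y
    exact ⟨S.mapX (IsCofiltered.minToRight i j) z⟩
  have : ∀ j, Finite (F.obj j) := fun j => S.finiteX j
  obtain ⟨s, hs⟩ := F.eval_section_surjective_of_surjective
    (fun i j f => S.surjective_mapX f) i y
  exact ⟨⟨s.1, fun i j f => s.2 f⟩, hs⟩

/-- The limit is closed in a product of finite discrete spaces. -/
instance : CompactSpace S.limX := by
  suffices h : IsClosed {x : (i : I) → S.X i | ∀ ⦃i j : I⦄ (f : i ⟶ j), S.mapX f (x i) = x j} from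
    isCompact_iff_compactSpace.1 h.isCompact
  simp only [Set.ofPred_forall]
  refine isClosed_iInter fun i => isClosed_iInter fun j => isClosed_iInter fun f => ?_
  exact isClosed_eq (continuous_of_discreteTopology.comp (continuous_apply i))
    (continuous_apply j)

/-- In a cofiltered diagram of discrete sets, a neighbourhood of a compatible family contains all
compatible families with the same value at some index. -/
theorem exists_index_of_mem_nhds {Y : I → Type u} [∀ i, TopologicalSpace (Y i)]
    [∀ i, DiscreteTopology (Y i)] (φ : ∀ {i j : I}, (i ⟶ j) → Y i → Y j)
    {a : ∀ i, Y i} (ha : ∀ {i j : I} (f : i ⟶ j), φ f (a i) = a j) {U : Set (∀ i, Y i)}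
    (hU : U ∈ 𝓝 a) (i₀ : I) : ∃ (i : I) (_ : i ⟶ i₀), ∀ b : ∀ i, Y i,
      (∀ {i j : I} (f : i ⟶ j), φ f (b i) = b j) → b i = a i → b ∈ U := by
  classical
  rw [nhds_pi, Filter.mem_pi] at hU
  obtain ⟨T, hT, t, ht, htU⟩ := hU
  -- A basic neighbourhood in the product restricts finitely many coordinates. An index below all of
  -- them determines them for compatible families, and one below `i₀` as well can be combined with
  -- earlier choices.
  obtain ⟨i, hi⟩ := IsCofiltered.inf_objs_exists (insert i₀ hT.toFinset)
  refine ⟨i, (hi (Finset.mem_insert_self _ _)).some, fun b hb hab => htU fun j hj => ?_⟩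
  obtain ⟨f⟩ := hi (Finset.mem_insert_of_mem (hT.mem_toFinset.2 hj))
  have : b j = a j := by rw [← hb f, hab, ha f]
  rw [this]
  exact mem_of_mem_nhds (ht j)

theorem exists_fibre_of_mem_nhds {x : S.limX} {U : Set S.limX} (hU : U ∈ 𝓝 x) (i₀ : I) :
    ∃ (i : I) (_ : i ⟶ i₀), ∀ z : S.limX, z.1 i = x.1 i → z ∈ U := by
  obtain ⟨V, hV, hVU⟩ := (mem_nhds_induced _ _ _).1 hU
  obtain ⟨i, f, hi⟩ := exists_index_of_mem_nhds S.mapX (fun f => x.2 f) hV i₀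
  exact ⟨i, f, fun z hz => hVU (hi z.1 (fun f => z.2 f) hz)⟩

theorem exists_fibre_of_eventually {p : S.limX → Prop} {x : S.limX} (hx : p x)
    {Q : {z // p z} → Prop} (hQ : ∀ᶠ z in 𝓝 ⟨x, hx⟩, Q z) (i₀ : I) :
    ∃ (i : I) (_ : i ⟶ i₀), ∀ z : {z // p z}, z.1.1 i = x.1 i → Q z := by
  obtain ⟨V, hV, hVU⟩ := (mem_nhds_induced _ _ _).1 hQ
  obtain ⟨i, f, hi⟩ := S.exists_fibre_of_mem_nhds hV i₀
  exact ⟨i, f, fun z hz => hVU (hi z.1 hz)⟩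

theorem exists_ker_of_mem_nhds {U : Set S.limG} (hU : U ∈ 𝓝 1) (i₀ : I) :
    ∃ (i : I) (_ : i ⟶ i₀), ∀ g : S.limG, g.1 i = 1 → g ∈ U := by
  obtain ⟨V, hV, hVU⟩ := (mem_nhds_induced _ _ _).1 hU
  obtain ⟨i, f, hi⟩ := exists_index_of_mem_nhds (fun f => S.mapG f) (fun f => map_one _) hV i₀
  exact ⟨i, f, fun g hg => hVU (hi g.1 (fun f => g.2 f) hg)⟩

/-- A property of points which holds at some stage of the diagram for each point of the limit over
`y : X i` holds at a single stage for all points over `y`. -/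
theorem exists_uniform {i : I} (y : S.X i) (P : ∀ {k : I}, (k ⟶ i) → S.X k → Prop)
    (hP : ∀ {k l : I} (g : k ⟶ l) (f : l ⟶ i) (z : S.X k), P f (S.mapX g z) → P (g ≫ f) z)
    (h : ∀ x : S.limX, x.1 i = y → ∃ (k : I) (f : k ⟶ i), P f (x.1 k)) :
    ∃ (k : I) (f : k ⟶ i), ∀ z : S.X k, S.mapX f z = y → P f z := by
  have hK : IsCompact {x : S.limX | x.1 i = y} :=
    (isClosed_eq ((continuous_apply i).comp continuous_subtype_val) continuous_const).isCompact
  have : Nonempty (Σ k, (k ⟶ i)) := ⟨⟨i, 𝟙 i⟩⟩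
  -- The sets where `P` holds at a given stage are open, cover the compact fibre over `y`, and are
  -- directed by `hP`, so one of them contains the fibre.
  obtain ⟨⟨k, f⟩, hk⟩ := hK.elim_directed_cover
    (fun q : Σ k, (k ⟶ i) => {x : S.limX | P q.2 (x.1 q.1)})
    (fun q => (isOpen_discrete {z | P q.2 z}).preimage
      ((continuous_apply q.1).comp continuous_subtype_val))
    (fun x hx => by
      obtain ⟨k, f, hk⟩ := h x hx
      exact Set.mem_iUnion.2 ⟨⟨k, f⟩, hk⟩)
    (fun ⟨k, f⟩ ⟨l, g⟩ => by
      -- A mere lower bound of `k` and `l` would not do: `P` depends on the map to `i`, so the two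
      -- composites must agree.
      obtain ⟨m, a, b, hab⟩ := IsCofiltered.cospan f g
      refine ⟨⟨m, a ≫ f⟩, fun x hx => hP a f (x.1 m) ?_, fun x hx => ?_⟩
      · rw [x.2 a]; exact hx
      · have := hP b g (x.1 m) (by rw [x.2 b]; exact hx)
        rwa [← hab] at this)
  refine ⟨k, f, fun z hz => ?_⟩
  obtain ⟨x, rfl⟩ := S.surjective_projX k z
  exact hk ((x.2 f).symm.trans hz)

end

end FiniteDiagram

end EquivariantSheaf

/-! ### Push-forward along composites, and local sections -/

namespace EquivariantSheaf

namespace ChangeMap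

section

variable {R : Type u} [Ring R]
  {G : Type u} [Group G] [TopologicalSpace G]
  {X : Type u} [TopologicalSpace X] [MulAction G X] [ContinuousSMul G X]
  {H : Type u} [Group H] [TopologicalSpace H]
  {Y : Type u} [TopologicalSpace Y] [MulAction H Y] [ContinuousSMul H Y]
  {K : Type u} [Group K] [TopologicalSpace K]
  {Z : Type u} [TopologicalSpace Z] [MulAction K Z]
  [DiscreteTopology H] [DiscreteTopology Y] [DiscreteTopology K] [DiscreteTopology Z]

/-- The canonical identification `r̄_* E = q̄_* p̄_* E` is an isomorphism. -/
theorem isIso_pushforwardComp (p : ChangeMap G X H Y) (q : ChangeMap H Y K Z)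
    (r : ChangeMap G X K Z)
    (hhom : ∀ g, r.hom g = q.hom (p.hom g)) (hmap : ∀ x, r.map x = q.map (p.map x))
    (E : GSheaf R G X) : IsIso (pushforwardComp p q r hhom hmap E) := by
  refine GSheaf.isIso_of_bijective _ fun z => ⟨fun s s' h => ?_, fun t => ?_⟩
  · refine Subtype.ext (funext fun x => ?_)
    have h1 := congrFun (congrArg Subtype.val h) ⟨p.map x, (hmap x).symm.trans x.2⟩
    exact congrFun (congrArg Subtype.val h1) ⟨x, rfl⟩
  · have hV : ∀ x : r.map ⁻¹' {z}, (x : X) ∈ p.map ⁻¹' (q.map ⁻¹' {z}) := fun x =>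
      (hmap x).symm.trans x.2
    -- Forgetting invariance under `ker q`, the family `t` glues to a section of `E`. This section
    -- is fixed by `ker p`; invariance under the larger group `ker r` comes back from that of `t`,
    -- as `p` maps `ker r` into `ker q`.
    let t' : (p.pushforwardObj E).sections (q.map ⁻¹' {z}) := ⟨t.1, t.2.1⟩
    let s' := p.pushforwardSections E (q.map ⁻¹' {z}) t'
    let s : (r.pushforwardObj E).stalk z :=
      ⟨fun x => s'.1 ⟨x, hV x⟩,
        s'.2.1.comp (f := fun x : r.map ⁻¹' {z} => (⟨x, hV x⟩ : p.map ⁻¹' (q.map ⁻¹' {z})))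
          (Continuous.subtype_mk continuous_subtype_val _),
        fun n hn x x' h => by
          have hn' : p.hom n ∈ q.hom.ker := by
            rw [MonoidHom.mem_ker] at hn ⊢
            rw [← hhom, hn]
          have h1 := t.2.2 (p.hom n) hn' ⟨p.map x, hV x⟩ ⟨p.map x', hV x'⟩ (p.smul_map_of_smul h)
          refine Eq.trans ?_ (congrFun (congrArg Subtype.val h1) ⟨x', rfl⟩)
          exact (p.pushforward_act_apply E n _ rfl (p.smul_map_of_smul h) (t.1 ⟨p.map x, hV x⟩)
            ⟨x, rfl⟩ ⟨x', rfl⟩ h).symm⟩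
    refine ⟨s, Subtype.ext (funext fun y => Subtype.ext (funext fun x => ?_))⟩
    obtain ⟨y, hy⟩ := y
    obtain ⟨x, hx⟩ := x
    have key : ∀ (y : Y) (hy : y ∈ q.map ⁻¹' {z}) (hx : p.map x = y),
        (t.1 ⟨p.map x, hx ▸ hy⟩).1 ⟨x, rfl⟩ = (t.1 ⟨y, hy⟩).1 ⟨x, hx⟩ := by
      rintro _ hy rfl; rfl
    exact key y hy hx

end

end ChangeMap

namespace GSheaf

section

variable {R : Type u} [Ring R] {G : Type u} [Group G] [TopologicalSpace G]
  {X : Type u} [TopologicalSpace X] [MulAction G X]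

theorem exists_isOpen_injOn (E : GSheaf R G X) (e : E.Total) :
    ∃ O : Set E.Total, IsOpen O ∧ e ∈ O ∧ Set.InjOn (Sigma.fst : E.Total → X) O := by
  obtain ⟨φ, hφ, h⟩ := E.isLocalHomeomorph e
  exact ⟨φ.source, φ.open_source, hφ, by rw [h]; exact φ.injOn⟩

theorem eq_of_injOn (E : GSheaf R G X) {O : Set E.Total}
    (hO : Set.InjOn (Sigma.fst : E.Total → X) O) {x : X} {a b : E.stalk x}
    (ha : (⟨x, a⟩ : E.Total) ∈ O) (hb : (⟨x, b⟩ : E.Total) ∈ O) : a = b := by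
  have := hO ha hb rfl
  simpa using this

/-- A family of elements of the fibres with values in an open set on which the projection is
injective is continuous. -/
theorem continuous_of_injOn (E : GSheaf R G X) {O : Set E.Total} (hO : IsOpen O)
    (hinj : Set.InjOn (Sigma.fst : E.Total → X) O) {U : Set X} (s : (x : U) → E.stalk x)
    (hs : ∀ x : U, (⟨x, s x⟩ : E.Total) ∈ O) :
    Continuous fun x : U => (⟨x, s x⟩ : E.Total) := by
  rw [continuous_def]
  intro W hW
  convert (E.isLocalHomeomorph.isOpenMap _ (hW.inter hO)).preimage
    (continuous_subtype_val (p := (· ∈ U))) using 1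
  ext x
  constructor
  · intro h
    exact ⟨_, ⟨h, hs x⟩, rfl⟩
  · rintro ⟨e, ⟨hW, hO⟩, he⟩
    have : e = ⟨x, s x⟩ := hinj hO (hs x) he
    rwa [this] at hW

theorem bijective_of_isIso {E F : GSheaf R G X} (f : E ⟶ F) [IsIso f] (x : X) :
    Function.Bijective (f.app x) := by
  refine Function.bijective_iff_has_inverse.2 ⟨Hom.app (inv f) x, fun a => ?_, fun a => ?_⟩
  · exact congrArg (fun m : E ⟶ E => m.app x a) (IsIso.hom_inv_id f)
  · exact congrArg (fun m : F ⟶ F => m.app x a) (IsIso.inv_hom_id f)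

end

end GSheaf

/-! ### Bijectivity of the counit, and of the unit at local objects -/

namespace DiagramSheaf

section

variable {R : Type u} [Ring R] {I : Type u} [SmallCategory I]
  {S : FiniteDiagram I}

theorem adjointStr_app_apply (D : DiagramSheaf R S) {i j : I} (f : i ⟶ j) (y : S.X j)
    (d : (D.obj j).stalk y) (z : (S.change f).map ⁻¹' {y}) :
    ((D.adjointStr f).app y d).1 z = (D.str f).app (z : S.X i)
      ((D.obj j).cast z.2.symm d : (D.obj j).stalk (S.mapX f z)) := by
  rw [adjointStr, Adjunction.homEquiv_unit]
  rfl

theorem isIso_of_app {D D' : DiagramSheaf R S} (a : D ⟶ D') [∀ i, IsIso (a.app i)] :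
    IsIso a := by
  refine ⟨⟨fun i => inv (a.app i), fun {i j} f => ?_⟩, ?_, ?_⟩
  · rw [Functor.map_inv, IsIso.inv_comp_eq, ← Category.assoc, a.comm, Category.assoc,
      IsIso.hom_inv_id, Category.comp_id]
  · ext i : 1
    exact IsIso.hom_inv_id (a.app i)
  · ext i : 1
    exact IsIso.inv_hom_id (a.app i)

variable [IsCofiltered I]

/-- `p̄_•` takes values in the local `G_•`-sheaves. -/
theorem isLocal_pushforwardDiagram (E : GSheaf R S.limG S.limX) :
    IsLocal R S ((pushforwardDiagram R S).obj E) := by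
  intro i j f
  have h : ((pushforwardDiagram R S).obj E).adjointStr f =
      ChangeMap.pushforwardComp (S.proj i) (S.change f) (S.proj j)
          (fun g => (g.2 f).symm) (fun x => (x.2 f).symm) E :=
    Equiv.apply_symm_apply _ _
  rw [h]
  exact ChangeMap.isIso_pushforwardComp _ _ _ _ _ E

/-- A section that vanishes at `x` vanishes on a fibre of some `p_k` with `k ⟶ i`. Restriction to
that fibre is the transition map, so the germ is already zero. -/
theorem injective_counit_app (E : GSheaf R S.limG S.limX) (x : S.limX) :
    Function.Injective (((colimAdj R S).counit.app E).app x) := by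
  rw [injective_iff_map_eq_zero]
  intro c hc
  obtain ⟨i, s, rfl⟩ := exists_germ_eq _ c
  replace hc := (colimAdj_counit_app E i x s).symm.trans hc
  have hev := E.eventually_eq (f := fun z : (S.proj i).map ⁻¹' {x.1 i} => (z : S.limX)) s.2.1
    (E.continuous_zero.comp continuous_subtype_val) (z₀ := ⟨x, rfl⟩) hc
  obtain ⟨k, f, hk⟩ := S.exists_fibre_of_eventually (p := fun z => z ∈ (S.proj i).map ⁻¹' {x.1 i})
    rfl hev i
  let D := (pushforwardDiagram R S).obj E
  have h0 : (D.str f).app (x.1 k) ((D.obj i).cast (x.2 f).symm s) = 0 := by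
    refine Subtype.ext (funext fun z => ?_)
    refine ((S.proj i).pushforward_cast_apply E (x.2 f).symm s
      ⟨z, ((z : S.limX).2 f).symm.trans (congrArg _ z.2)⟩).trans ?_
    exact hk ⟨z, _⟩ z.2
  have h1 := D.germ_str f x rfl ((D.obj i).cast (x.2 f).symm s) (x.2 f)
  rw [h0, map_zero, map_zero] at h1
  rw [h1]
  exact congrArg (D.germ i x)
    (((D.obj i).cast_cast (x.2 f).symm (x.2 f) s).trans ((D.obj i).cast_rfl _ s)).symm

/-- A slice `O` through `e` gives a section `s` over a fibre. For `n` near `1` and `w` near a point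
`z`, continuity of the action keeps `n • s w` in `O`, where it must equal `s (n • w)` because `O`
meets each stalk at most once. Shrinking the fibre makes `s` fixed by the kernel. -/
theorem surjective_counit_app (E : GSheaf R S.limG S.limX) (x : S.limX) :
    Function.Surjective (((colimAdj R S).counit.app E).app x) := by
  intro e
  obtain ⟨O, hO, heO, hinj⟩ := E.exists_isOpen_injOn ⟨x, e⟩
  have : Nonempty I := IsCofiltered.nonempty
  obtain ⟨i, -, hi⟩ := S.exists_fibre_of_mem_nhds
    (E.isLocalHomeomorph.isOpenMap.image_mem_nhds (hO.mem_nhds heO)) (Classical.arbitrary I)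
  let U : Set S.limX := (S.proj i).map ⁻¹' {x.1 i}
  have hs : ∀ z : U, ∃ a : E.stalk z, (⟨z, a⟩ : E.Total) ∈ O := fun z => by
    obtain ⟨⟨z', a⟩, ha, h⟩ := hi z z.2
    obtain rfl : z' = z := h
    exact ⟨a, ha⟩
  choose s hs using hs
  have hsc := E.continuous_of_injOn hO hinj s hs
  obtain ⟨k, f, hk⟩ := S.exists_uniform (x.1 i)
    (fun {k} _ w => ∀ n : S.limG, n.1 k = 1 → ∀ (z z' : U) (h : n • (z : S.limX) = z'),
      z.1.1 k = w → E.act n h (s z) = s z')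
    (fun {k l} g f w hw n hn z z' h hz => hw n (by rw [← n.2 g, hn, map_one]) z z' h
      (by rw [← z.1.2 g, hz]))
    (fun z hz => by
      let z₀ : U := ⟨z, hz⟩
      have hact : ∀ᶠ q in 𝓝 ((1 : S.limG), (⟨z, s z₀⟩ : E.Total)),
          (⟨q.1 • q.2.1, E.act q.1 rfl q.2.2⟩ : E.Total) ∈ O := by
        refine E.continuous_act.continuousAt.preimage_mem_nhds (hO.mem_nhds ?_)
        rw [E.mk_act 1 (one_smul _ z), E.act_one]
        exact hs z₀
      rw [nhds_prod_eq] at hact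
      obtain ⟨A, hA, B, hB, hAB⟩ := Filter.mem_prod_iff.1 hact
      obtain ⟨k, f, hk⟩ := S.exists_ker_of_mem_nhds hA i
      obtain ⟨l, g, hl⟩ := S.exists_fibre_of_eventually (p := (· ∈ U)) hz
        (hsc.continuousAt.preimage_mem_nhds hB) k
      refine ⟨l, g ≫ f, fun n hn w w' h hw => ?_⟩
      have h1 : (⟨w, s w⟩ : E.Total) ∈ B := hl w hw
      have h2 := hAB (Set.mk_mem_prod (hk n (by rw [← n.2 g, hn, map_one])) h1)
      have h3 : (⟨n • (w : S.limX), E.act n rfl (s w)⟩ : E.Total) ∈ O := h2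
      rw [E.mk_act n h] at h3
      exact E.eq_of_injOn hinj h3 (hs w'))
  -- Of the stage found above, only the fibre through `x` matters: restricted to it, `s` is a fixed
  -- section whose germ at `x` is sent to `e`.
  have hU : ∀ z : (S.proj k).map ⁻¹' {x.1 k}, (z : S.limX) ∈ U := fun z =>
    ((z.1.2 f).symm.trans (congrArg _ z.2)).trans (x.2 f)
  let t : ((S.proj k).pushforwardObj E).stalk (x.1 k) :=
    ⟨fun z => s ⟨z, hU z⟩, hsc.comp (f := fun z : (S.proj k).map ⁻¹' {x.1 k} => (⟨z, hU z⟩ : U))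
        (Continuous.subtype_mk continuous_subtype_val _),
      fun n hn z z' h => hk (x.1 k) (x.2 f) n hn ⟨z, hU z⟩ ⟨z', hU z'⟩ h z.2⟩
  refine ⟨_, (colimAdj_counit_app E k x t).trans ?_⟩
  exact E.eq_of_injOn hinj (hs ⟨x, rfl⟩) heO

instance isIso_colimAdj_counit : IsIso (colimAdj R S).counit := by
  have : ∀ E, IsIso ((colimAdj R S).counit.app E) := fun E =>
    GSheaf.isIso_of_bijective _ fun x => ⟨injective_counit_app E x, surjective_counit_app E x⟩
  exact NatIso.isIso_of_isIso_app _

/-- If all germs of `d` vanish, each point of the limit over `y` kills `d` at some stage, and by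
compactness one stage `f` kills it at all points over `y`. Then the adjoint structure map of `f`
sends `d` to zero, and it is injective. -/
theorem injective_unit_app {D : DiagramSheaf R S} (hD : IsLocal R S D) (i : I) (y : S.X i) :
    Function.Injective ((((colimAdj R S).unit.app D).app i).app y) := by
  rw [injective_iff_map_eq_zero]
  intro d hd
  have hg : ∀ (x : S.limX) (hx : x.1 i = y), D.germ i x ((D.obj i).cast hx.symm d) = 0 :=
    fun x hx => by
      refine (colimAdj_unit_app D i y d ⟨x, hx⟩).symm.trans ?_
      rw [hd]
      rfl
  obtain ⟨k, f, hk⟩ := S.exists_uniform y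
    -- Transporting `d` to the stalk at `mapX f w` requires `w` to lie over `y`; quantifying over
    -- the proof makes the condition vacuous elsewhere.
    (fun {k} f w => ∀ h : y = S.mapX f w, (D.str f).app w ((D.obj i).cast h d) = 0)
    (fun {k l} g f w hw h => by
      rw [D.str_comp_app]
      have h' : y = S.mapX f (S.mapX g w) := h.trans (S.mapX_comp g f w)
      refine (congrArg ((D.str g).app w) (Eq.trans ?_ (hw h'))).trans (map_zero _)
      exact congrArg ((D.str f).app (S.mapX g w)) ((D.obj i).cast_cast _ _ d))
    (fun x hx => by
      obtain ⟨k, f, h⟩ := D.exists_str_eq_zero (hg x hx)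
      refine ⟨k, f, fun h' => Eq.trans ?_ h⟩
      exact congrArg ((D.str f).app (x.1 k)) ((D.obj i).cast_cast _ _ d).symm)
  have := hD f
  apply (GSheaf.bijective_of_isIso (D.adjointStr f) y).1
  rw [map_zero]
  refine Subtype.ext (funext fun z => ?_)
  exact (D.adjointStr_app_apply f y d z).trans (hk z z.2 _)

/-- Near each point, `s` consists of the germs of one element of some `D k`. By compactness a single
stage `f : k ⟶ i` provides elements `d z` for all `z` over `y`. Injectivity of the unit at `k`
forces them to form a fixed family, and locality of `D` gives a preimage of this family in `D i`. -/
theorem surjective_unit_app {D : DiagramSheaf R S} (hD : IsLocal R S D) (i : I) (y : S.X i) :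
    Function.Surjective ((((colimAdj R S).unit.app D).app i).app y) := by
  intro s
  obtain ⟨k, f, hk⟩ := S.exists_uniform y
    (fun {k} _ w => ∃ d : (D.obj k).stalk w, ∀ (x : (S.proj i).map ⁻¹' {y}) (hx : w = x.1.1 k),
      D.germ k x ((D.obj k).cast hx d) = s.1 x)
    (fun {k l} g f w hw => by
      obtain ⟨d, hd⟩ := hw
      refine ⟨(D.str g).app w d, fun x hx => ?_⟩
      rw [← hd x ((congrArg _ hx).trans (x.1.2 g))]
      exact D.germ_str g x hx d _)
    (fun x hx => by
      obtain ⟨k, d, hd⟩ := exists_germ_eq D (s.1 ⟨x, hx⟩)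
      let u := (((colimAdj R S).unit.app D).app k).app (x.1 k) d
      -- The section `s` lives over a fibre of `p_i` and the germs of `d` over a fibre of `p_k`;
      -- they are compared on the intersection.
      let p : S.limX → Prop := fun z => z.1 i = y ∧ z.1 k = x.1 k
      have hp : p x := ⟨hx, rfl⟩
      have hs' := s.2.1.comp (f := fun z : {z // p z} => (⟨z, z.2.1⟩ : (S.proj i).map ⁻¹' {y}))
        (Continuous.subtype_mk continuous_subtype_val _)
      have hu' := u.2.1.comp
        (f := fun z : {z // p z} => (⟨z, z.2.2⟩ : (S.proj k).map ⁻¹' {x.1 k}))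
        (Continuous.subtype_mk continuous_subtype_val _)
      have hxu : u.1 ⟨x, rfl⟩ = s.1 ⟨x, hx⟩ := by
        refine (colimAdj_unit_app D k (x.1 k) d ⟨x, rfl⟩).trans ?_
        rw [← hd]
        exact congrArg (D.germ k x) ((D.obj k).cast_rfl _ d)
      have hev := GSheaf.eventually_eq _ (f := fun z : {z // p z} => (z : S.limX)) hu' hs'
        (z₀ := ⟨x, hp⟩) hxu
      -- The index `k` representing the germ comes with no map to `i`, so `l` is taken below both.
      obtain ⟨l, g, hl⟩ := S.exists_fibre_of_eventually hp hev (IsCofiltered.min k i)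
      let gk := g ≫ IsCofiltered.minToLeft k i
      refine ⟨l, g ≫ IsCofiltered.minToRight k i,
        (D.str gk).app (x.1 l) ((D.obj k).cast (x.2 gk).symm d), fun z hz => ?_⟩
      have hzk : x.1 k = z.1.1 k := by rw [← x.2 gk, ← z.1.2 gk, hz]
      have h1 := hl ⟨z, z.2, hzk.symm⟩ hz.symm
      refine Eq.trans ?_ h1
      refine (D.germ_str gk z hz _ ((x.2 gk).trans hzk)).trans ?_
      refine Eq.trans ?_ (colimAdj_unit_app D k (x.1 k) d ⟨z, hzk.symm⟩).symm
      exact congrArg (D.germ k z) ((D.obj k).cast_cast _ _ d))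
  choose d hd using hk
  have := hD f
  let t : ((S.change f).pushforwardObj (D.obj k)).stalk y :=
    ⟨fun z => d z z.2, continuous_of_discreteTopology, fun n hn z z' h => by
      -- Invariance is checked on germs, where it follows from that of `s`. For this `n` is lifted
      -- to some `g` in the limit group; since `n` lies in the kernel of `G k → G i`, the lift `g`
      -- lies in `ker p_i^G`.
      apply injective_unit_app hD k
      refine Subtype.ext (funext fun x => ?_)
      rw [colimAdj_unit_app, colimAdj_unit_app]
      obtain ⟨g, rfl⟩ := S.surjective_projG k n
      have hg : g.1 i = 1 := (g.2 f).symm.trans hn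
      have hx : x.1.1 k = z' := x.2
      have hx₀ : (g⁻¹ • (x : S.limX)).1 k = z := by
        rw [S.smul_apply, hx, ← h]
        exact inv_smul_smul _ _
      have hx' : x.1.1 i = y := by rw [← x.1.2 f, hx]; exact z'.2
      have hx₀' : (g⁻¹ • (x : S.limX)).1 i = y := by
        rw [← (g⁻¹ • (x : S.limX)).2 f, hx₀]; exact z.2
      refine Eq.trans ?_ (hd z' z'.2 ⟨x, hx'⟩ hx.symm).symm
      refine Eq.trans ?_ (s.2.2 g hg ⟨_, hx₀'⟩ ⟨x, hx'⟩ (smul_inv_smul g _))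
      rw [← hd z z.2 ⟨_, hx₀'⟩ hx₀.symm]
      refine Eq.trans ?_ (D.act_germ k g (smul_inv_smul g _)
        (congrArg (fun w : S.limX => w.1 k) (smul_inv_smul g (x : S.limX))) _).symm
      refine congrArg (D.germ k x) ?_
      exact ((D.obj k).cast_act _ _ _).trans ((D.obj k).act_cast _ _ _).symm⟩
  obtain ⟨e, he⟩ := (GSheaf.bijective_of_isIso (D.adjointStr f) y).2 t
  refine ⟨e, Subtype.ext (funext fun x => ?_)⟩
  rw [colimAdj_unit_app]
  have hxf : S.mapX f (x.1.1 k) = y := (x.1.2 f).trans x.2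
  rw [← hd (x.1.1 k) hxf x rfl]
  have h1 := (D.adjointStr_app_apply f y e ⟨x.1.1 k, hxf⟩).symm
  rw [he] at h1
  refine Eq.trans ?_ ((D.germ_str f x rfl ((D.obj i).cast hxf.symm e) (x.1.2 f)).symm.trans ?_)
  · exact congrArg (D.germ i x) ((D.obj i).cast_cast _ _ e).symm
  · exact congrArg (fun a => D.germ k x ((D.obj k).cast rfl a)) h1

theorem isIso_colimAdj_unit_app {D : DiagramSheaf R S} (hD : IsLocal R S D) :
    IsIso ((colimAdj R S).unit.app D) := by
  have : ∀ i, IsIso (((colimAdj R S).unit.app D).app i) := fun i =>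
    GSheaf.isIso_of_bijective _ fun y => ⟨injective_unit_app hD i y, surjective_unit_app hD i y⟩
  exact isIso_of_app _

end

end DiagramSheaf

/-- An adjunction whose right adjoint takes values in a full subcategory restricts to it; if the
counit is an isomorphism, and the unit is one on the subcategory, then this is an equivalence. -/
theorem exists_adjunction_restrict {C D : Type*} [Category* C] [Category* D] {L : C ⥤ D}
    {Q : D ⥤ C} (adj : L ⊣ Q) {P : ObjectProperty C} (hP : ∀ E, P (Q.obj E))
    (hcounit : IsIso adj.counit) (hunit : ∀ A, P A → IsIso (adj.unit.app A)) :
    ∃ adj' : P.ι ⋙ L ⊣ P.lift Q hP,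
      (∀ A, (adj'.unit.app A).hom = adj.unit.app A.obj) ∧
      (∀ E, adj'.counit.app E = adj.counit.app E) ∧
      IsIso adj'.unit ∧ IsIso adj'.counit ∧ (P.ι ⋙ L).IsEquivalence := by
  let adj' : P.ι ⋙ L ⊣ P.lift Q hP := Adjunction.mkOfUnitCounit
    { unit :=
        { app := fun A => ObjectProperty.homMk (adj.unit.app A.obj)
          naturality := fun A B f => ObjectProperty.hom_ext _ (adj.unit.naturality f.hom) }
      counit :=
        { app := fun E => adj.counit.app E
          naturality := fun E E' f => adj.counit.naturality f }
      left_triangle := by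
        ext A
        exact (congrArg (L.map (adj.unit.app A.obj) ≫ ·) (Category.id_comp
          (adj.counit.app (L.obj A.obj)))).trans (adj.left_triangle_components A.obj)
      right_triangle := by
        ext E
        exact (congrArg (adj.unit.app (Q.obj E) ≫ ·) (Category.id_comp
          (Q.map (adj.counit.app E)))).trans (adj.right_triangle_components E) }
  have hiu : IsIso adj'.unit := by
    have : ∀ A, IsIso (adj'.unit.app A) := fun A => by
      -- Isomorphisms in a full subcategory are detected in the ambient category.
      rw [← ObjectProperty.isIso_hom_iff]
      exact hunit A.obj A.property
    exact NatIso.isIso_of_isIso_app _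
  have hic : IsIso adj'.counit := by
    have : ∀ E, IsIso (adj'.counit.app E) := fun E =>
      inferInstanceAs (IsIso (adj.counit.app E))
    exact NatIso.isIso_of_isIso_app _
  exact ⟨adj', fun _ => rfl, fun _ => rfl, hiu, hic, adj'.toEquivalence.isEquivalence_functor⟩

end EquivariantSheaf

theorem theorem11p5 {I : Type u} [SmallCategory I] [IsCofiltered I] (R : Type u) [Ring R]
    (S : FiniteDiagram I) :
    ∃ _ : HasColimitsOfShape Iᵒᵖ (GSheaf R S.limG S.limX),
    ∃ adj : DiagramSheaf.pullbackDiagram R S ⋙ colim ⊣ DiagramSheaf.pushforwardDiagram R S,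
      IsIso adj.counit ∧
      ∃ hlocal : ∀ E, DiagramSheaf.IsLocal R S ((DiagramSheaf.pushforwardDiagram R S).obj E),
      ∃ adj' : (DiagramSheaf.IsLocal R S).ι ⋙ DiagramSheaf.pullbackDiagram R S ⋙ colim ⊣
          (DiagramSheaf.IsLocal R S).lift (DiagramSheaf.pushforwardDiagram R S) hlocal,
        (∀ D, (adj'.unit.app D).hom = adj.unit.app D.obj) ∧
        (∀ E, adj'.counit.app E = adj.counit.app E) ∧
        IsIso adj'.unit ∧ IsIso adj'.counit ∧
        ((DiagramSheaf.IsLocal R S).ι ⋙ DiagramSheaf.pullbackDiagram R S ⋙ colim).IsEquivalence := by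
  have hlocal := DiagramSheaf.isLocal_pushforwardDiagram (R := R) (S := S)
  obtain ⟨adj', h⟩ := exists_adjunction_restrict (DiagramSheaf.colimAdj R S) hlocal
    DiagramSheaf.isIso_colimAdj_counit fun D hD => DiagramSheaf.isIso_colimAdj_unit_app hD
  exact ⟨inferInstance, DiagramSheaf.colimAdj R S, inferInstance, hlocal, adj', h⟩
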